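/- **Setting.** Let $\eta,\mu,\sigma,\delta$ be real numbers with $0<\eta<\mu<2\eta$, $\sigma>0$, $\delta>0$. For $\gamma>0$ consider the HJB equation $$\max_{0\le u\le 1,\ 0\le \xi\le x}\Big\{\tfrac12(\sigma u)^2v''(x)+[\eta-(1-u)\mu]v'(x)-\delta v(x)+\gamma[\xi+v(x-\xi)-v(x)]\Big\}=0\quad (x>0),\qquad v(0)=0. \tag{HJB}$$ A solution is a function $v$, continuous on $[0,\infty)$ and $C^2$ on $(0,\infty)$, for which the maximum is attained and equal to $0$ for every $x>0$, and $v(0)=0$. For such $v$ put $$x_\gamma=\inf\Big\{x>0:-\frac{\mu v'(x)}{\sigma^2v''(x)}\ge1\Big\},\qquad b_\gamma=\inf\{x>0:v'(x)<1\}.$$ **Notation.** Let $\lambda_\gamma$ be the negative root of $\frac{\sigma^2}{2}r^2+\eta r-(\delta+\gamma)=0$ and $$\bar\eta=\frac{2\sigma^2}{\mu^2},\quad D=1+\delta\bar\eta,\quad c_{2,1}=\frac{\bar\eta(\mu-\eta)}{D},\quad \alpha_\gamma=\frac{\gamma+\delta}{\gamma}\Big[1+\frac{\mu}{\sigma^2\lambda_\gamma}\Big],\quad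 c_{3,2}=-\frac{\mu}{\sigma^2\alpha_\gamma\lambda_\gamma^2}.$$ Let $g$ and $G$ be the density and the distribution function of the gamma law with shape $\bar\eta(\delta+\gamma)+1$ and rate $\gamma\bar\eta$. For $\beta\in\mathbb R$, $z\geq e^{-\beta}$ and $k\in\mathbb R$ let $$H_\beta(z)=\int_{e^{-\beta}}^z\frac{dy}{y^2g(y)},\qquad \bar f_{\beta,k}(z)=k\,[G(z)-G(e^{-\beta})]-\bar\eta(\mu-\eta)\Big[G(z)H_\beta(z)-\int_{e^{-\beta}}^z\frac{G(y)}{y^2g(y)}dy\Big],$$ $$c_{3,1}(\beta)=\frac{\sigma^2}{\mu\alpha_\gamma g(\alpha_\gamma)}+\bar\eta(\mu-\eta)H_\beta(\alpha_\gamma),\qquad c_{3,3}(\beta)=\frac{\bar\eta(\mu-\eta)}{e^{-\beta}g(e^{-\beta})}.$$ Let $$f_1(\gamma)=\frac1{\lambda_\gamma\delta}\Big[\delta+\frac{\lambda_\gamma\eta\gamma}{\delta+\gamma}\Big],\quad f_3(\gamma)=\frac{\sigma^2e^{\bar\eta\gamma\alpha_\gamma}}{\mu\,\alpha_\gamma^{\bar\eta(\delta+\gamma)+1}}+\bar\eta(\mu-\eta)\int_1^{\alpha_\gamma}\frac{e^{\bar\eta\gamma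 y}}{y^{\bar\eta(\delta+\gamma)+2}}dy,\quad f_4(\gamma)=\bar\eta(\mu-\eta)e^{\bar\eta\gamma},$$ let $\gamma_1>0$ be the point with $f_1(\gamma_1)=\frac{2\eta-\mu}{2\delta}$, and let $\gamma_2\in(0,\gamma_1)$ satisfy $f_3(\gamma_2)=f_4(\gamma_2)$. **(i)** Let $\gamma\in(\gamma_2,\gamma_1)$ and put $$M_\gamma=\frac1D\ln\Big[\frac1{\delta\bar\eta}\Big\{\frac{g(1)}{c_{2,1}}c_{3,1}(0)-1\Big\}\Big],\quad b=c_{2,1}\Big[\frac{\delta\bar\eta}{D}\big(e^{DM_\gamma}-1\big)+M_\gamma\Big],\quad x_b=\bar f_{0,c_{3,1}(0)}(\alpha_\gamma)+b.$$ Then $M_\gamma>0$, and $0<b<x_b$. The function $z\mapsto x_1(z)=\frac{\delta\bar\eta c_{2,1}}{D}e^{D(z+M_\gamma)}+c_{2,1}z+c_{2,1}\big[M_\gamma-\frac{\delta\bar\eta}{D}\big]$ is a bijection from $[-M_\gamma,0]$ onto $[0,b]$, and $z\mapsto x_2(z)=\bar f_{0,c_{3,1}(0)}(e^z)+b$ is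 a bijection from $[0,\ln\alpha_\gamma]$ onto $[b,x_b]$. The function $$v(x)=\begin{cases}c_{2,1}e^{-z}\big[e^{D(M_\gamma+z)}-1\big],\quad z=x_1^{-1}(x),& 0\le x\le b,\\[2pt] \dfrac{e^{-z}}{\delta+\gamma}\Big\{\dfrac{g(e^z)e^z}{\bar\eta}\big[c_{3,1}(0)-\bar\eta(\mu-\eta)H_0(e^z)\big]-(\mu-\eta)\Big\}+\dfrac{\gamma[v(b)+x-b]}{\delta+\gamma},\quad z=x_2^{-1}(x),& b<x\le x_b,\\[6pt] c_{3,2}e^{\lambda_\gamma(x-x_b)}+\dfrac{\gamma}{\gamma+\delta}\Big[x-b+v(b)+\dfrac{\eta}{\delta+\gamma}\Big],&x>x_b\end{cases}$$ is a $C^2$, increasing and concave solution of (HJB), $v''<0$ on $(0,\infty)$, and $v'/v''$ is decreasing on $(0,\infty)$. Moreover $b_\gamma=b$ and $x_\gamma=x_b=\bar f_{0,c_{3,1}(0)}(\alpha_\gamma)+b_\gamma>b_\gamma$. **(ii)** Let $\gamma\in(0,\gamma_2)$. There is a unique $M\in(0,\ln\alpha_\gamma)$ with $$\frac{\mu-\eta}{e^Mg(e^M)}=\frac{\mu}{2\alpha_\gamma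 g(\alpha_\gamma)}+(\mu-\eta)H_{-M}(\alpha_\gamma).$$ With $x_0=\bar f_{-M,c_{3,3}(-M)}(\alpha_\gamma)$, the function $z\mapsto x_2(z)=\bar f_{-M,c_{3,3}(-M)}(e^z)$ is a bijection from $[M,\ln\alpha_\gamma]$ onto $[0,x_0]$, and $$v(x)=\begin{cases}\dfrac{e^{-z}}{\delta+\gamma}\Big\{\dfrac{g(e^z)e^z}{\bar\eta}\big[c_{3,3}(-M)-\bar\eta(\mu-\eta)H_{-M}(e^z)\big]-(\mu-\eta)\Big\}+\dfrac{\gamma x}{\delta+\gamma},\quad z=x_2^{-1}(x),& 0\le x\le x_0,\\[6pt] c_{3,2}e^{\lambda_\gamma(x-x_0)}+\dfrac{\gamma}{\gamma+\delta}\Big[x+\dfrac{\eta}{\delta+\gamma}\Big],&x>x_0\end{cases}$$ is a $C^2$, increasing and concave solution of (HJB), $v''<0$ on $(0,\infty)$, and $v'/v''$ is decreasing on $(0,\infty)$. Moreover $b_\gamma=0$ and $x_\gamma=x_0$. Here "increasing" and "decreasing" are meant strictly, and the infima defining $x_\gamma$ and $b_\gamma$ are over nonempty sets. -/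

import Mathlib

open Set

noncomputable section

namespace PeriodicDividend

/-- The parameters that do not depend on the payout intensity: the safety loadings `η` (insurer)
and `μ` (reinsurer), the volatility `σ` and the discount rate `δ`. Only numbers; the sign and order
conditions are hypotheses of the theorem. -/
structure Params where
  η : ℝ
  μ : ℝ
  σ : ℝ
  δ : ℝ

/-! ### The HJB equation -/

/-- The expression under the maximum of the HJB equation:
`(1/2)(σu)² v''(x) + (η - (1-u)μ) v'(x) - δ v(x) + γ (ξ + v(x-ξ) - v(x))`. -/
def hamiltonian (P : Params) (γ : ℝ) (v : ℝ → ℝ) (x u ξ : ℝ) : ℝ :=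
  1 / 2 * (P.σ * u) ^ 2 * deriv (deriv v) x + (P.η - (1 - u) * P.μ) * deriv v x - P.δ * v x
    + γ * (ξ + v (x - ξ) - v x)

/-- `v` is a classical solution of the HJB equation: continuous on `[0, ∞)`, twice continuously
differentiable on `(0, ∞)`, `v 0 = 0`, and for every `x > 0` the maximum of the Hamiltonian over
`0 ≤ u ≤ 1`, `0 ≤ ξ ≤ x` is attained and equals `0`. -/
structure IsHJBSolution (P : Params) (γ : ℝ) (v : ℝ → ℝ) : Prop where
  continuousOn : ContinuousOn v (Ici 0)
  contDiffOn : ContDiffOn ℝ 2 v (Ioi 0)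
  zero : v 0 = 0
  hjb : ∀ x, 0 < x →
    IsGreatest {y | ∃ u ∈ Icc (0 : ℝ) 1, ∃ ξ ∈ Icc 0 x, y = hamiltonian P γ v x u ξ} 0

/-- `xγ` is the maximum-risk level of `v`, the infimum of the `x > 0` with
`-μ v'(x) / (σ² v''(x)) ≥ 1`. (In `ℝ`, `IsGLB` forces the set to be nonempty, that is, the infimum
to be finite.) -/
def IsRiskLevel (P : Params) (v : ℝ → ℝ) (xγ : ℝ) : Prop :=
  IsGLB {x | 0 < x ∧ 1 ≤ -(P.μ * deriv v x / (P.σ ^ 2 * deriv (deriv v) x))} xγ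

/-- `b` is the payout level of `v`, the (finite) infimum of the `x > 0` with `v'(x) < 1`. -/
def IsPayoutLevel (v : ℝ → ℝ) (b : ℝ) : Prop :=
  IsGLB {x | 0 < x ∧ deriv v x < 1} b

/-- The properties asserted of an explicit solution: it solves the HJB equation, is `C²`,
increasing and concave, with `v'' < 0` on `(0, ∞)`, so that `v' / v''` makes sense there, and
`v' / v''` is decreasing on `(0, ∞)`. -/
structure IsGoodSolution (P : Params) (γ : ℝ) (v : ℝ → ℝ) : Prop where
  isHJBSolution : IsHJBSolution P γ v
  increasing : StrictMonoOn v (Ici 0)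
  concave : ConcaveOn ℝ (Ici 0) v
  deriv2_neg : ∀ x, 0 < x → deriv (deriv v) x < 0
  ratio_decreasing : StrictAntiOn (fun x => deriv v x / deriv (deriv v) x) (Ioi 0)

/-! ### Constants and auxiliary functions -/

/-- `λ_γ`, the negative root of `(σ²/2) r² + η r - (δ + γ) = 0`. -/
def lam (P : Params) (γ : ℝ) : ℝ :=
  (-P.η - √(P.η ^ 2 + 2 * P.σ ^ 2 * (P.δ + γ))) / P.σ ^ 2

theorem eq_lam_iff (P : Params) (γ : ℝ) (hη : 0 < P.η) (hσ : 0 < P.σ) (hδγ : 0 < P.δ + γ) (r : ℝ) :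
    r = lam P γ ↔ r < 0 ∧ P.σ ^ 2 / 2 * r ^ 2 + P.η * r - (P.δ + γ) = 0 := by
  have hs2 : 0 < P.σ ^ 2 := by positivity
  have hnn : 0 ≤ P.η ^ 2 + 2 * P.σ ^ 2 * (P.δ + γ) := by positivity
  have hsq := Real.sq_sqrt hnn
  have hs0 := Real.sqrt_nonneg (P.η ^ 2 + 2 * P.σ ^ 2 * (P.δ + γ))
  have hgt : P.η < √(P.η ^ 2 + 2 * P.σ ^ 2 * (P.δ + γ)) := by
    apply Real.lt_sqrt_of_sq_lt
    have : 0 < 2 * P.σ ^ 2 * (P.δ + γ) := by positivity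
    linarith
  unfold lam
  generalize √(P.η ^ 2 + 2 * P.σ ^ 2 * (P.δ + γ)) = s at *
  rw [eq_div_iff hs2.ne']
  constructor
  · intro h
    have hr : r < 0 := by
      by_contra hc
      have : 0 ≤ r * P.σ ^ 2 := mul_nonneg (not_lt.mp hc) hs2.le
      linarith
    refine ⟨hr, ?_⟩
    have : P.σ ^ 2 * (P.σ ^ 2 / 2 * r ^ 2 + P.η * r - (P.δ + γ)) = 0 := by
      have e : s = -P.η - r * P.σ ^ 2 := by linarith
      rw [e] at hsq
      nlinarith
    exact (mul_eq_zero.mp this).resolve_left hs2.ne'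
  · rintro ⟨hr, h⟩
    have h2 : (r * P.σ ^ 2 + P.η + s) * (r * P.σ ^ 2 + P.η - s) = 0 := by
      have : (r * P.σ ^ 2 + P.η) ^ 2 = s ^ 2 := by
        rw [hsq]
        linear_combination 2 * P.σ ^ 2 * h
      linear_combination this
    rcases mul_eq_zero.mp h2 with h3 | h3
    · linarith
    · have : r * P.σ ^ 2 < 0 := mul_neg_of_neg_of_pos hr hs2
      linarith

/-- The function `f₁`. -/
def f1 (P : Params) (γ : ℝ) : ℝ :=
  1 / (lam P γ * P.δ) * (P.δ + lam P γ * P.η * γ / (P.δ + γ))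

/-- `γ₁ = f₁⁻¹((2η - μ) / (2δ))`, where `f₁` is considered on `(0, ∞)`. -/
def gamma1 (P : Params) : ℝ :=
  Function.invFunOn (f1 P) (Ioi 0) ((2 * P.η - P.μ) / (2 * P.δ))

/-- `η̄ = 2σ²/μ²`. -/
def etaBar (P : Params) : ℝ := 2 * P.σ ^ 2 / P.μ ^ 2

/-- `c_{2,1} = η̄(μ - η) / (1 + δη̄)`. -/
def c21 (P : Params) : ℝ := etaBar P * (P.μ - P.η) / (1 + P.δ * etaBar P)

/-- `k_{2,1} = δη̄ c_{2,1} / (1 + δη̄)`. -/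
def k21 (P : Params) : ℝ := P.δ * etaBar P * c21 P / (1 + P.δ * etaBar P)

/-- `α_γ`, which is also `f₂(γ)`. -/
def alpha (P : Params) (γ : ℝ) : ℝ :=
  (γ + P.δ) / γ * (1 + P.μ / (P.σ ^ 2 * lam P γ))

/-- The function `f₃`. -/
def f3 (P : Params) (γ : ℝ) : ℝ :=
  P.σ ^ 2 * Real.exp (etaBar P * γ * alpha P γ)
      / (P.μ * alpha P γ ^ (etaBar P * (P.δ + γ) + 1))
    + etaBar P * (P.μ - P.η) *
      ∫ y in (1 : ℝ)..alpha P γ,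
        Real.exp (etaBar P * γ * y) / y ^ (etaBar P * (P.δ + γ) + 2)

/-- The function `f₄`. -/
def f4 (P : Params) (γ : ℝ) : ℝ :=
  etaBar P * (P.μ - P.η) * Real.exp (etaBar P * γ)

/-- The gamma density `g` with shape `η̄(δ + γ) + 1` and rate `γη̄` (scale `1/(γη̄)`). -/
def g (P : Params) (γ : ℝ) (x : ℝ) : ℝ :=
  ProbabilityTheory.gammaPDFReal (etaBar P * (P.δ + γ) + 1) (γ * etaBar P) x

/-- The distribution function `G` of the gamma law with density `g`. -/
def G (P : Params) (γ : ℝ) (x : ℝ) : ℝ :=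
  ProbabilityTheory.cdf
    (ProbabilityTheory.gammaMeasure (etaBar P * (P.δ + γ) + 1) (γ * etaBar P)) x

/-- `H_β(z) = ∫_{e^{-β}}^z dy / (y² g(y))`. -/
def H (P : Params) (γ β z : ℝ) : ℝ :=
  ∫ y in Real.exp (-β)..z, 1 / (y ^ 2 * g P γ y)

/-- `c_{3,1}(β)`. -/
def c31 (P : Params) (γ β : ℝ) : ℝ :=
  P.σ ^ 2 / (P.μ * alpha P γ * g P γ (alpha P γ))
    + etaBar P * (P.μ - P.η) * H P γ β (alpha P γ)

/-- `c_{3,3}(β)`. -/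
def c33 (P : Params) (γ β : ℝ) : ℝ :=
  etaBar P * (P.μ - P.η) / (Real.exp (-β) * g P γ (Real.exp (-β)))

/-- `c_{3,2}(α_γ) = -μ / (σ² α_γ λ_γ²)`. -/
def c32 (P : Params) (γ : ℝ) : ℝ :=
  -(P.μ / (P.σ ^ 2 * alpha P γ * lam P γ ^ 2))

/-- The function `f̄_β`, with the coefficient `k` in front of `G(z) - G(e^{-β})`; `k` is
`c_{3,1}(β)` in the case of a positive payout level and `c_{3,3}(β)` when this level is zero. -/
def fBar (P : Params) (γ k β z : ℝ) : ℝ :=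
  k * (G P γ z - G P γ (Real.exp (-β)))
    - etaBar P * (P.μ - P.η) *
      (G P γ z * H P γ β z - ∫ y in Real.exp (-β)..z, G P γ y / (y ^ 2 * g P γ y))

/-- The formula of the solution on the intermediate interval, as a function of `x` and of the value
`z` at `x` of the inverse function of `𝓍₂`; `vb` stands for `v(b)`. -/
def middlePiece (P : Params) (γ k β b vb z x : ℝ) : ℝ :=
  Real.exp (-z) / (P.δ + γ) *
      (g P γ (Real.exp z) * Real.exp z / etaBar P
        * (k - etaBar P * (P.μ - P.η) * H P γ β (Real.exp z)) - (P.μ - P.η))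
    + γ * (vb + x - b) / (P.δ + γ)

/-- The formula of the solution to the right of the maximum-risk level `xb`. -/
def lastPiece (P : Params) (γ b vb xb x : ℝ) : ℝ :=
  c32 P γ * Real.exp (lam P γ * (x - xb))
    + γ / (γ + P.δ) * (x - b + vb + P.η / (P.δ + γ))

/-! ### Positive payout level -/

/-- `M_γ` of the case `γ₂ < γ < γ₁`. -/
def bigM (P : Params) (γ : ℝ) : ℝ :=
  1 / (1 + P.δ * etaBar P) *
    Real.log (1 / (P.δ * etaBar P) * (g P γ 1 / c21 P * c31 P γ 0 - 1))

/-- `b_γ` of the case `γ₂ < γ < γ₁`. -/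
def bLevel (P : Params) (γ : ℝ) : ℝ :=
  c21 P * (etaBar P * P.δ / (1 + P.δ * etaBar P)
    * (Real.exp (bigM P γ * (1 + P.δ * etaBar P)) - 1) + bigM P γ)

/-- `f̄₀(α_γ) + b_γ`. -/
def xLevel (P : Params) (γ : ℝ) : ℝ :=
  fBar P γ (c31 P γ 0) 0 (alpha P γ) + bLevel P γ

/-- The function `𝓍₁`, used on `[-M_γ, 0]`. -/
def x1 (P : Params) (γ z : ℝ) : ℝ :=
  k21 P * Real.exp ((1 + P.δ * etaBar P) * (z + bigM P γ)) + c21 P * z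
    + c21 P * (bigM P γ - P.δ * etaBar P / (1 + P.δ * etaBar P))

/-- The function `𝓍₂` (with `M₂ = 0`), used on `[0, ln α_γ]`. -/
def x2 (P : Params) (γ z : ℝ) : ℝ :=
  fBar P γ (c31 P γ 0) 0 (Real.exp z) + bLevel P γ

/-- The inverse function of `𝓍₁` on `[-M_γ, 0]`. -/
def x1Inv (P : Params) (γ : ℝ) : ℝ → ℝ :=
  Function.invFunOn (x1 P γ) (Icc (-bigM P γ) 0)

/-- The inverse function of `𝓍₂` on `[0, ln α_γ]`. -/
def x2Inv (P : Params) (γ : ℝ) : ℝ → ℝ :=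
  Function.invFunOn (x2 P γ) (Icc 0 (Real.log (alpha P γ)))

/-- The formula of the solution on `[0, b_γ]`. -/
def firstPiece (P : Params) (γ x : ℝ) : ℝ :=
  c21 P * Real.exp (-x1Inv P γ x) *
    (Real.exp ((1 + P.δ * etaBar P) * (bigM P γ + x1Inv P γ x)) - 1)

/-- The explicit solution with `M₂ = 0`, `b = b_γ` and `x_b = f̄₀(α_γ) + b_γ`. -/
def vPos (P : Params) (γ x : ℝ) : ℝ :=
  if x ≤ bLevel P γ then firstPiece P γ x
  else if x ≤ xLevel P γ then
    middlePiece P γ (c31 P γ 0) 0 (bLevel P γ) (firstPiece P γ (bLevel P γ)) (x2Inv P γ x) x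
  else lastPiece P γ (bLevel P γ) (firstPiece P γ (bLevel P γ)) (xLevel P γ) x

/-! ### Zero payout level -/

/-- `M` is a positive solution of
`(μ-η) / (e^M g(e^M)) = μ / (2 α_γ g(α_γ)) + (μ-η) H_{-M}(α_γ)`.
As `H_{-M}` is defined only to the right of `e^M`, it is required that `e^M < α_γ`. -/
def IsBigMZero (P : Params) (γ M : ℝ) : Prop :=
  0 < M ∧ Real.exp M < alpha P γ ∧
    (P.μ - P.η) / (Real.exp M * g P γ (Real.exp M))
      = P.μ / (2 * alpha P γ * g P γ (alpha P γ)) + (P.μ - P.η) * H P γ (-M) (alpha P γ)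

/-- `f̄_{-M}(α_γ)`, with the coefficient `c_{3,3}(-M)`. -/
def xLevelZero (P : Params) (γ M : ℝ) : ℝ :=
  fBar P γ (c33 P γ (-M)) (-M) (alpha P γ)

/-- The function `𝓍₂(z) = f̄_{-M}(e^z)`, used on `[M, ln α_γ]`. -/
def x2Zero (P : Params) (γ M z : ℝ) : ℝ :=
  fBar P γ (c33 P γ (-M)) (-M) (Real.exp z)

/-- Its inverse function on `[M, ln α_γ]`. -/
def x2ZeroInv (P : Params) (γ M : ℝ) : ℝ → ℝ :=
  Function.invFunOn (x2Zero P γ M) (Icc M (Real.log (alpha P γ)))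

/-- The explicit solution with payout level `0`. -/
def vZero (P : Params) (γ M x : ℝ) : ℝ :=
  if x ≤ xLevelZero P γ M then
    middlePiece P γ (c33 P γ (-M)) (-M) 0 0 (x2ZeroInv P γ M x) x
  else lastPiece P γ 0 0 (xLevelZero P γ M) x

end PeriodicDividend

end

/-!
Away from the boundary, write `z = -log v'(x)` and let `χ = -v'/v''` be the risk tolerance, so that
`x'(z) = χ`. The optimal retention is `min 1 (μχ/σ²)` and the optimal payout is `x - min x b` where
`v' = 1` at `b` (or `b = 0` if `v' < 1` throughout), and with these inserted the HJB equation becomes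
an identity between `v`, `z` and `χ`. Differentiated in `z`, it is a linear equation for `χ`, solved by
an exponential below `b` (`firstTol`) and by the gamma density between `b` and the maximum-risk level
(`riskTol`, `hasDerivAt_riskTol`). Beyond that level full retention makes the equation linear in `v`.

Everything asserted of `v` follows once `χ` is continuous, positive and strictly increasing and equals
`σ²/μ` at the maximum-risk level: `IsValueCurve` records this, `IsValueCurve.glue` joins pieces which
agree to second order, and `IsValueCurve.isGoodSolution` is the verification of the HJB equation. The
constant `α_γ` is the value of `1/v'` at the maximum-risk level. At `z = log α_γ` the equation for `χ`
gives a positive derivative (`loading_lt_at_alpha`), and this propagates to all smaller `z`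
(`riskTol_deriv_pos`).

It remains to see where the risk tolerance, followed back from `z = log α_γ`, starts. At `x = 0` it must
be `η̄(μ - η)`. At `z = 0` it is `g(1) c₃₁(0) = η̄(μ - η) f₃(γ)/f₄(γ)` (`g_one_mul_c31`). If `f₃ > f₄`,
the piece below `b` fits in between; if `f₃ < f₄`, the value `η̄(μ - η)` is reached at some
`z = M ∈ (0, log α_γ)`, and the payout level is `0` (`exists_unique_isBigMZero`). Since `α_γ > 1` for
`γ < γ₁` (`one_lt_alpha`) and `f₃/f₄` is strictly increasing on `(0, γ₁)` (`f3Ratio_lt`), the sign of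
`f₃ - f₄` is the sign of `γ - γ₂`.
-/

namespace PeriodicDividend

/-! ### Concave value functions and their risk tolerance -/

theorem hasDerivWithinAt_ite {f₁ f₂ f₁' f₂' : ℝ → ℝ} {p q : ℝ} (hpq : p ≤ q)
    (h₁ : ∀ x ∈ Icc p q, HasDerivWithinAt f₁ (f₁' x) (Icc p q) x)
    (h₂ : ∀ x ∈ Ici q, HasDerivWithinAt f₂ (f₂' x) (Ici q) x)
    (hf : f₁ q = f₂ q) (hf' : f₁' q = f₂' q) {x : ℝ} (hx : x ∈ Ici p) :
    HasDerivWithinAt (fun y => if y ≤ q then f₁ y else f₂ y)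
      (if x ≤ q then f₁' x else f₂' x) (Ici p) x := by
  have e₁ : EqOn (fun y => if y ≤ q then f₁ y else f₂ y) f₁ (Icc p q) :=
    fun y hy => if_pos hy.2
  have e₂ : EqOn (fun y => if y ≤ q then f₁ y else f₂ y) f₂ (Ici q) := by
    intro y hy
    rcases eq_or_lt_of_le (mem_Ici.mp hy) with rfl | hlt
    · simp [hf]
    · exact if_neg hlt.not_ge
  rw [← Icc_union_Ici_eq_Ici hpq]
  refine HasDerivWithinAt.union ?_ ?_
  · by_cases hq : x ≤ q
    · rw [if_pos hq]
      exact (h₁ x ⟨hx, hq⟩).congr e₁ (e₁ ⟨hx, hq⟩)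
    · refine HasFDerivWithinAt.of_notMem_closure ?_
      rw [isClosed_Icc.closure_eq]
      exact fun h => hq h.2
  · by_cases hq : q ≤ x
    · have : (if x ≤ q then f₁' x else f₂' x) = f₂' x := by
        rcases eq_or_lt_of_le hq with rfl | hlt
        · simp [hf']
        · exact if_neg hlt.not_ge
      rw [this]
      exact (h₂ x hq).congr e₂ (e₂ hq)
    · refine HasFDerivWithinAt.of_notMem_closure ?_
      rw [isClosed_Ici.closure_eq]
      exact hq

theorem continuousOn_ite_Ici {f₁ f₂ : ℝ → ℝ} {p q : ℝ} (hpq : p ≤ q)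
    (h₁ : ContinuousOn f₁ (Icc p q)) (h₂ : ContinuousOn f₂ (Ici q)) (hf : f₁ q = f₂ q) :
    ContinuousOn (fun y => if y ≤ q then f₁ y else f₂ y) (Ici p) := by
  rw [← Icc_union_Ici_eq_Ici hpq]
  refine ContinuousOn.union_of_isClosed ?_ ?_ isClosed_Icc isClosed_Ici
  · exact h₁.congr fun y hy => if_pos hy.2
  · refine h₂.congr fun y hy => ?_
    rcases eq_or_lt_of_le (mem_Ici.mp hy) with rfl | hlt
    · simp [hf]
    · exact if_neg hlt.not_ge

theorem strictMonoOn_ite_Ici {f₁ f₂ : ℝ → ℝ} {p q : ℝ}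
    (h₁ : StrictMonoOn f₁ (Icc p q)) (h₂ : StrictMonoOn f₂ (Ici q)) (hf : f₁ q = f₂ q) :
    StrictMonoOn (fun y => if y ≤ q then f₁ y else f₂ y) (Ici p) := by
  intro x hx y hy hxy
  have hx' := mem_Ici.mp hx
  by_cases hyq : y ≤ q
  · simpa only [if_pos hyq, if_pos (hxy.le.trans hyq)] using
      h₁ ⟨hx, hxy.le.trans hyq⟩ ⟨hy, hyq⟩ hxy
  · have hyq' : q < y := not_le.mp hyq
    by_cases hxq : x ≤ q
    · simp only [if_pos hxq, if_neg hyq]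
      have a : f₁ x ≤ f₁ q := h₁.monotoneOn ⟨hx, hxq⟩ ⟨hx'.trans hxq, le_rfl⟩ hxq
      have b : f₂ q < f₂ y := h₂ self_mem_Ici hyq'.le hyq'
      linarith
    · simpa only [if_neg hyq, if_neg hxq] using h₂ (not_le.mp hxq).le hyq'.le hxy

/-- The data of a concave value function `v` on a set `S`: `w` is its derivative and `χ = -v'/v''`
its risk tolerance, so that `v'' = -w/χ`. The risk tolerance is continuous, positive and strictly
increasing. Derivatives are taken within `S`, so that pieces over adjacent closed intervals can be
joined. -/
structure IsValueCurve (v w χ : ℝ → ℝ) (S : Set ℝ) : Prop where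
  deriv_v : ∀ x ∈ S, HasDerivWithinAt v (w x) S x
  deriv_w : ∀ x ∈ S, HasDerivWithinAt w (-(w x / χ x)) S x
  w_pos : ∀ x ∈ S, 0 < w x
  χ_pos : ∀ x ∈ S, 0 < χ x
  χ_cont : ContinuousOn χ S
  χ_mono : StrictMonoOn χ S

theorem IsValueCurve.congr {v w χ v' w' χ' : ℝ → ℝ} {S : Set ℝ} (h : IsValueCurve v w χ S)
    (hv : EqOn v' v S) (hw : EqOn w' w S) (hχ : EqOn χ' χ S) : IsValueCurve v' w' χ' S where
  deriv_v x hx := by rw [hw hx]; exact (h.deriv_v x hx).congr hv (hv hx)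
  deriv_w x hx := by rw [hw hx, hχ hx]; exact (h.deriv_w x hx).congr hw (hw hx)
  w_pos x hx := by rw [hw hx]; exact h.w_pos x hx
  χ_pos x hx := by rw [hχ hx]; exact h.χ_pos x hx
  χ_cont := h.χ_cont.congr hχ
  χ_mono := h.χ_mono.congr hχ.symm

/-- Two value curves over adjacent intervals which agree to second order at the common endpoint
form a value curve. -/
theorem IsValueCurve.glue {v₁ w₁ χ₁ v₂ w₂ χ₂ : ℝ → ℝ} {p q : ℝ} (hpq : p ≤ q)
    (h₁ : IsValueCurve v₁ w₁ χ₁ (Icc p q)) (h₂ : IsValueCurve v₂ w₂ χ₂ (Ici q))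
    (hv : v₁ q = v₂ q) (hw : w₁ q = w₂ q) (hχ : χ₁ q = χ₂ q) :
    IsValueCurve (fun x => if x ≤ q then v₁ x else v₂ x) (fun x => if x ≤ q then w₁ x else w₂ x)
      (fun x => if x ≤ q then χ₁ x else χ₂ x) (Ici p) where
  deriv_v _ hx := hasDerivWithinAt_ite hpq h₁.deriv_v h₂.deriv_v hv hw hx
  deriv_w x hx := by
    have := hasDerivWithinAt_ite hpq h₁.deriv_w h₂.deriv_w hw (by simp only [hw, hχ]) hx
    by_cases hq : x ≤ q
    · simpa only [if_pos hq] using this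
    · simpa only [if_neg hq] using this
  w_pos x hx := by
    by_cases hq : x ≤ q
    · simpa only [if_pos hq] using h₁.w_pos x ⟨hx, hq⟩
    · simpa only [if_neg hq] using h₂.w_pos x (not_le.mp hq).le
  χ_pos x hx := by
    by_cases hq : x ≤ q
    · simpa only [if_pos hq] using h₁.χ_pos x ⟨hx, hq⟩
    · simpa only [if_neg hq] using h₂.χ_pos x (not_le.mp hq).le
  χ_cont := continuousOn_ite_Ici hpq h₁.χ_cont h₂.χ_cont hχ
  χ_mono := strictMonoOn_ite_Ici h₁.χ_mono h₂.χ_mono hχ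

/-! ### Parametrization by the logarithm of the marginal value -/

theorem sub_le_of_deriv_ge {f X : ℝ → ℝ} {m M : ℝ}
    (hf : ∀ z ∈ Icc m M, HasDerivAt f (X z) z) (hX : MonotoneOn X (Icc m M))
    {a b : ℝ} (ha : a ∈ Icc m M) (hb : b ∈ Icc m M) (hab : a ≤ b) :
    X m * (b - a) ≤ f b - f a := by
  have hm : MonotoneOn (fun z => f z - X m * z) (Icc m M) := by
    refine monotoneOn_of_hasDerivWithinAt_nonneg (f' := fun z => X z - X m) (convex_Icc m M) ?_ ?_ ?_
    · exact fun z hz => ((hf z hz).continuousAt.sub (by fun_prop)).continuousWithinAt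
    · intro z hz
      have hz' := interior_subset hz
      exact (((hf z hz').sub ((hasDerivAt_id z).const_mul (X m))).congr_deriv
        (by rw [mul_one])).hasDerivWithinAt
    · intro z hz
      have hz' := interior_subset hz
      exact sub_nonneg.mpr (hX ⟨le_rfl, hz'.1.trans hz'.2⟩ hz' hz'.1)
  have := hm ha hb hab
  simp only at this
  linarith

theorem bijOn_of_deriv_pos {f X : ℝ → ℝ} {m M : ℝ} (hmM : m ≤ M)
    (hf : ∀ z ∈ Icc m M, HasDerivAt f (X z) z) (hX : MonotoneOn X (Icc m M)) (hpos : 0 < X m) :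
    StrictMonoOn f (Icc m M) ∧ BijOn f (Icc m M) (Icc (f m) (f M)) := by
  have hs : StrictMonoOn f (Icc m M) := by
    intro a ha b hb hab
    have := sub_le_of_deriv_ge hf hX ha hb hab.le
    have : 0 < X m * (b - a) := mul_pos hpos (sub_pos.mpr hab)
    linarith
  refine ⟨hs, ?_, hs.injOn, ?_⟩
  · exact fun z hz => ⟨hs.monotoneOn ⟨le_rfl, hmM⟩ hz hz.1, hs.monotoneOn hz ⟨hmM, le_rfl⟩ hz.2⟩
  · exact intermediate_value_Icc hmM fun z hz => (hf z hz).continuousAt.continuousWithinAt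

/-- A value function given parametrically: at `x = f z` the marginal value is `e^{-z}`, and the
risk tolerance is `X = f'`. -/
theorem isValueCurve_of_parametrization {f X V : ℝ → ℝ} {m M : ℝ} (hmM : m ≤ M)
    (hf : ∀ z ∈ Icc m M, HasDerivAt f (X z) z)
    (hV : ∀ z ∈ Icc m M, HasDerivAt V (Real.exp (-z) * X z) z)
    (hXc : ContinuousOn X (Icc m M)) (hX : StrictMonoOn X (Icc m M)) (hpos : 0 < X m) :
    IsValueCurve (fun x => V (Function.invFunOn f (Icc m M) x))
      (fun x => Real.exp (-Function.invFunOn f (Icc m M) x))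
      (fun x => X (Function.invFunOn f (Icc m M) x)) (Icc (f m) (f M)) := by
  obtain ⟨hs, hbij⟩ := bijOn_of_deriv_pos hmM hf hX.monotoneOn hpos
  set Z := Function.invFunOn f (Icc m M) with hZ
  have hmem : MapsTo Z (Icc (f m) (f M)) (Icc m M) := hbij.surjOn.mapsTo_invFunOn
  have hright : ∀ x ∈ Icc (f m) (f M), f (Z x) = x := hbij.surjOn.rightInvOn_invFunOn
  have hXpos : ∀ z ∈ Icc m M, 0 < X z := fun z hz =>
    hpos.trans_le (hX.monotoneOn ⟨le_rfl, hmM⟩ hz hz.1)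
  have hmono : StrictMonoOn Z (Icc (f m) (f M)) := by
    intro x hx y hy hxy
    by_contra h
    have := hs.monotoneOn (hmem hy) (hmem hx) (not_lt.mp h)
    rw [hright x hx, hright y hy] at this
    exact absurd hxy this.not_gt
  have hcont : ContinuousOn Z (Icc (f m) (f M)) := by
    have key : ∀ x ∈ Icc (f m) (f M), ∀ y ∈ Icc (f m) (f M), x ≤ y →
        |Z x - Z y| ≤ (X m)⁻¹ * |x - y| := by
      intro x hx y hy hxy
      have hle := hmono.monotoneOn hx hy hxy
      have := sub_le_of_deriv_ge hf hX.monotoneOn (hmem hx) (hmem hy) hle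
      rw [hright x hx, hright y hy] at this
      rw [abs_of_nonpos (by linarith), abs_of_nonpos (by linarith), inv_mul_eq_div,
        le_div_iff₀ hpos]
      linarith
    refine LipschitzOnWith.continuousOn (K := (X m)⁻¹.toNNReal)
      (LipschitzOnWith.of_dist_le_mul fun x hx y hy => ?_)
    rw [Real.coe_toNNReal _ (inv_nonneg.mpr hpos.le), Real.dist_eq, Real.dist_eq]
    rcases le_total x y with h | h
    · exact key x hx y hy h
    · rw [abs_sub_comm (Z x), abs_sub_comm x]
      exact key y hy x hx h
  have hZd : ∀ x ∈ Icc (f m) (f M), HasDerivWithinAt Z (X (Z x))⁻¹ (Icc (f m) (f M)) x := by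
    intro x hx
    have hne := (hXpos _ (hmem hx)).ne'
    have hd := (hf _ (hmem hx)).hasFDerivAt_equiv hne
    have ht : Filter.Tendsto Z (nhdsWithin x (Icc (f m) (f M))) (nhdsWithin (Z x) univ) := by
      rw [nhdsWithin_univ]; exact hcont x hx
    have := (hd.hasFDerivWithinAt (s := univ)).of_local_left_inverse ht hx
      (Filter.eventually_of_mem self_mem_nhdsWithin hright)
    exact this.hasDerivWithinAt.congr_deriv (by simp)
  constructor
  · intro x hx
    have hne := (hXpos _ (hmem hx)).ne'
    refine ((hV _ (hmem hx)).comp_hasDerivWithinAt x (hZd x hx)).congr_deriv ?_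
    field_simp
  · intro x hx
    refine ((hZd x hx).neg.exp).congr_deriv ?_
    simp only [Pi.neg_apply, div_eq_mul_inv, mul_neg]
  · exact fun x _ => Real.exp_pos _
  · exact fun x hx => hXpos _ (hmem hx)
  · exact hXc.comp hcont hmem
  · exact hX.comp hmono hmem

/-! ### Verification of the HJB equation -/

theorem IsValueCurve.hasDerivAt {v w χ : ℝ → ℝ} (h : IsValueCurve v w χ (Ici 0)) {x : ℝ}
    (hx : 0 < x) : HasDerivAt v (w x) x ∧ HasDerivAt w (-(w x / χ x)) x :=
  ⟨(h.deriv_v x hx.le).hasDerivAt (Ici_mem_nhds hx),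
    (h.deriv_w x hx.le).hasDerivAt (Ici_mem_nhds hx)⟩

theorem IsValueCurve.deriv_deriv {v w χ : ℝ → ℝ} (h : IsValueCurve v w χ (Ici 0)) {x : ℝ}
    (hx : 0 < x) : deriv (deriv v) x = -(w x / χ x) := by
  have : deriv v =ᶠ[nhds x] w :=
    Filter.eventually_of_mem (Ioi_mem_nhds hx) fun y hy => (h.hasDerivAt hy).1.deriv
  rw [this.deriv_eq, (h.hasDerivAt hx).2.deriv]

theorem IsValueCurve.contDiffOn {v w χ : ℝ → ℝ} (h : IsValueCurve v w χ (Ici 0)) :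
    ContDiffOn ℝ 2 v (Ioi 0) := by
  have hd : EqOn (deriv v) w (Ioi 0) := fun y hy => (h.hasDerivAt hy).1.deriv
  rw [show (2 : WithTop ℕ∞) = 1 + 1 by norm_num, contDiffOn_succ_iff_deriv_of_isOpen isOpen_Ioi]
  refine ⟨fun x hx => (h.hasDerivAt hx).1.differentiableAt.differentiableWithinAt,
    by simp, ?_⟩
  rw [show (1 : WithTop ℕ∞) = 0 + 1 by norm_num, contDiffOn_succ_iff_deriv_of_isOpen isOpen_Ioi]
  refine ⟨?_, by simp, ?_⟩
  · exact DifferentiableOn.congr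
      (fun x hx => (h.hasDerivAt hx).2.differentiableAt.differentiableWithinAt) hd
  · rw [contDiffOn_zero]
    have hw : ContinuousOn w (Ioi 0) :=
      fun x hx => (h.hasDerivAt hx).2.continuousAt.continuousWithinAt
    have hχ := h.χ_cont.mono (Ioi_subset_Ici_self (a := (0 : ℝ)))
    exact ((hw.div hχ fun x hx => (h.χ_pos x (mem_Ioi.mp hx).le).ne').neg).congr
      fun x hx => h.deriv_deriv hx

theorem IsValueCurve.w_anti {v w χ : ℝ → ℝ} (h : IsValueCurve v w χ (Ici 0)) :
    StrictAntiOn w (Ici 0) := by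
  refine strictAntiOn_of_hasDerivWithinAt_neg (f' := fun x => -(w x / χ x)) (convex_Ici 0)
    (fun x hx => (h.deriv_w x hx).continuousWithinAt) ?_ ?_
  · intro x hx
    rw [interior_Ici] at hx ⊢
    exact (h.hasDerivAt hx).2.hasDerivWithinAt
  · intro x hx
    have hx' := interior_subset hx
    exact neg_neg_of_pos (div_pos (h.w_pos x hx') (h.χ_pos x hx'))

/-- If the marginal value exceeds `1` up to the level `b` and is below `1` beyond it, the best
lump-sum payout takes the surplus down to `min x b`. -/
theorem IsValueCurve.payout_le {v w χ : ℝ → ℝ} (h : IsValueCurve v w χ (Ici 0)) {b : ℝ}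
    (hb : 0 ≤ b) (hlow : ∀ x, 0 < x → x ≤ b → 1 ≤ w x) (hhigh : ∀ x, b < x → w x < 1)
    {x y : ℝ} (hy : 0 ≤ y) (hyx : y ≤ x) : v y - y ≤ v (min x b) - min x b := by
  have hc : ContinuousOn (fun x => v x - x) (Ici 0) := fun x hx =>
    ((h.deriv_v x hx).continuousWithinAt).sub continuousWithinAt_id
  have hmono : MonotoneOn (fun x => v x - x) (Icc 0 b) := by
    refine monotoneOn_of_hasDerivWithinAt_nonneg (f' := fun x => w x - 1) (convex_Icc 0 b)
      (hc.mono Icc_subset_Ici_self) ?_ ?_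
    · intro z hz
      have hz0 : 0 < z := (interior_Icc (a := (0 : ℝ)) (b := b) ▸ hz).1
      exact ((h.hasDerivAt hz0).1.sub (hasDerivAt_id z)).hasDerivWithinAt
    · intro z hz
      rw [interior_Icc] at hz
      exact sub_nonneg.mpr (hlow z hz.1 hz.2.le)
  have hanti : AntitoneOn (fun x => v x - x) (Ici b) := by
    refine antitoneOn_of_hasDerivWithinAt_nonpos (f' := fun x => w x - 1) (convex_Ici b)
      (hc.mono (Ici_subset_Ici.mpr hb)) ?_ ?_
    · intro z hz
      rw [interior_Ici] at hz
      exact ((h.hasDerivAt (hb.trans_lt hz)).1.sub (hasDerivAt_id z)).hasDerivWithinAt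
    · intro z hz
      rw [interior_Ici] at hz
      exact sub_nonpos.mpr (hhigh z hz).le
  rcases le_total x b with hxb | hbx
  · rw [min_eq_left hxb]
    exact hmono ⟨hy, hyx.trans hxb⟩ ⟨hy.trans hyx, hxb⟩ hyx
  · rw [min_eq_right hbx]
    rcases le_total y b with hyb | hby
    · exact hmono ⟨hy, hyb⟩ ⟨hb, le_rfl⟩ hyb
    · exact hanti self_mem_Ici hby hby

theorem IsValueCurve.isPayoutLevel {v w χ : ℝ → ℝ} (h : IsValueCurve v w χ (Ici 0)) {b : ℝ}
    (hb : 0 ≤ b) (hlow : ∀ x, 0 < x → x ≤ b → 1 ≤ w x) (hhigh : ∀ x, b < x → w x < 1) :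
    IsPayoutLevel v b := by
  have hset : {x | 0 < x ∧ deriv v x < 1} = Ioi b := by
    ext x
    simp only [mem_ofPred_eq, mem_Ioi]
    constructor
    · rintro ⟨hx, hd⟩
      by_contra hc
      rw [(h.hasDerivAt hx).1.deriv] at hd
      exact absurd hd (hlow x hx (not_lt.mp hc)).not_gt
    · intro hx
      have hx0 := hb.trans_lt hx
      exact ⟨hx0, by rw [(h.hasDerivAt hx0).1.deriv]; exact hhigh x hx⟩
  unfold IsPayoutLevel
  rw [hset]
  exact isGLB_Ioi

theorem IsValueCurve.isRiskLevel {v w χ : ℝ → ℝ} (h : IsValueCurve v w χ (Ici 0)) {P : Params}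
    (hμ : 0 < P.μ) (hσ : 0 < P.σ) {c : ℝ} (hc : 0 < c) (hχc : χ c = P.σ ^ 2 / P.μ) :
    IsRiskLevel P v c := by
  have hset : {x | 0 < x ∧ 1 ≤ -(P.μ * deriv v x / (P.σ ^ 2 * deriv (deriv v) x))} = Ici c := by
    ext x
    simp only [mem_ofPred_eq, mem_Ici]
    have key : 0 < x → (1 ≤ -(P.μ * deriv v x / (P.σ ^ 2 * deriv (deriv v) x)) ↔ c ≤ x) := by
      intro hx
      have hw := h.w_pos x hx.le
      rw [(h.hasDerivAt hx).1.deriv, h.deriv_deriv hx, ← h.χ_mono.le_iff_le hc.le hx.le, hχc,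
        div_le_iff₀ hμ]
      have : -(P.μ * w x / (P.σ ^ 2 * -(w x / χ x))) = χ x * P.μ / P.σ ^ 2 := by
        field_simp
      rw [this, le_div_iff₀ (by positivity), one_mul]
    exact ⟨fun hx => (key hx.1).1 hx.2, fun hx => ⟨hc.trans_le hx, (key (hc.trans_le hx)).2 hx⟩⟩
  unfold IsRiskLevel
  rw [hset]
  exact isGLB_Ici

/-- Verification: a value curve which satisfies the reduced equations, with the optimal retention
`min 1 (μχ/σ²)` and the optimal payout `x - min x b` inserted, solves the HJB equation. -/
theorem IsValueCurve.isGoodSolution {v w χ : ℝ → ℝ} (h : IsValueCurve v w χ (Ici 0)) {P : Params}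
    {γ : ℝ} (hγ : 0 < γ) (hμ : 0 < P.μ) (hσ : 0 < P.σ) (h0 : v 0 = 0) {b c : ℝ} (hb : 0 ≤ b)
    (hc : 0 < c) (hχc : χ c = P.σ ^ 2 / P.μ)
    (hlow : ∀ x, 0 < x → x ≤ b → 1 ≤ w x) (hhigh : ∀ x, b < x → w x < 1)
    (heq₁ : ∀ x, 0 < x → x ≤ c → w x * (χ x / etaBar P - (P.μ - P.η)) - P.δ * v x
      + γ * (x - min x b + v (min x b) - v x) = 0)
    (heq₂ : ∀ x, c < x → 1 / 2 * P.σ ^ 2 * (-(w x / χ x)) + P.η * w x - P.δ * v x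
      + γ * (x - min x b + v (min x b) - v x) = 0) :
    IsGoodSolution P γ v := by
  have hcont : ContinuousOn v (Ici 0) := fun x hx => (h.deriv_v x hx).continuousWithinAt
  refine ⟨⟨hcont, h.contDiffOn, h0, ?_⟩, ?_, ?_, ?_, ?_⟩
  · intro x hx
    have hw := h.w_pos x hx.le
    have hχ := h.χ_pos x hx.le
    have hdv := (h.hasDerivAt hx).1.deriv
    have hddv := h.deriv_deriv hx
    have hmin : 0 ≤ min x b := le_min hx.le hb
    have hη : P.μ * etaBar P * P.μ = 2 * P.σ ^ 2 := by
      unfold etaBar; field_simp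
    have hηpos : 0 < etaBar P := by unfold etaBar; positivity
    have hq : χ x / etaBar P = P.μ ^ 2 * χ x / (2 * P.σ ^ 2) := by
      rw [← hη]; field_simp
    constructor
    · rcases le_or_gt x c with hxc | hxc
      · refine ⟨P.μ * χ x / P.σ ^ 2, ⟨by positivity, ?_⟩, x - min x b,
          ⟨by linarith [min_le_left x b], by linarith⟩, ?_⟩
        · have := h.χ_mono.monotoneOn hx.le hc.le hxc
          rw [hχc, le_div_iff₀ hμ] at this
          rw [div_le_one (by positivity)]
          linarith
        · rw [← heq₁ x hx hxc, hamiltonian, hdv, hddv, sub_sub_cancel, hq]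
          field_simp
          ring
      · refine ⟨1, ⟨zero_le_one, le_rfl⟩, x - min x b,
          ⟨by linarith [min_le_left x b], by linarith⟩, ?_⟩
        rw [← heq₂ x hxc, hamiltonian, hdv, hddv, sub_sub_cancel]
        ring
    · rintro _ ⟨u, hu, ξ, hξ, rfl⟩
      have hp := h.payout_le hb hlow hhigh (y := x - ξ) (x := x) (by linarith [hξ.2])
        (by linarith [hξ.1])
      have hp' : γ * (ξ + v (x - ξ) - v x) ≤ γ * (x - min x b + v (min x b) - v x) :=
        mul_le_mul_of_nonneg_left (by linarith) hγ.le
      rw [hamiltonian, hdv, hddv]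
      rcases le_or_gt x c with hxc | hxc
      · have e := heq₁ x hx hxc
        rw [hq] at e
        have hsq : w x * (P.μ ^ 2 * χ x / (2 * P.σ ^ 2) - (P.μ - P.η))
            - (1 / 2 * (P.σ * u) ^ 2 * -(w x / χ x) + (P.η - (1 - u) * P.μ) * w x)
            = w x / (2 * χ x) * (P.σ * u - P.μ * χ x / P.σ) ^ 2 := by
          field_simp
          ring
        have : 0 ≤ w x / (2 * χ x) * (P.σ * u - P.μ * χ x / P.σ) ^ 2 := by positivity
        linarith
      · have e := heq₂ x hxc
        have hχx := h.χ_mono hc.le hx.le hxc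
        rw [hχc, div_lt_iff₀ hμ] at hχx
        have hsq : 1 / 2 * P.σ ^ 2 * (-(w x / χ x)) + P.η * w x
            - (1 / 2 * (P.σ * u) ^ 2 * -(w x / χ x) + (P.η - (1 - u) * P.μ) * w x)
            = w x / χ x * ((1 - u) * (χ x * P.μ - 1 / 2 * P.σ ^ 2 * (1 + u))) := by
          field_simp
          ring
        have h1 : 1 / 2 * P.σ ^ 2 * (1 + u) ≤ P.σ ^ 2 := by nlinarith [hu.2, sq_nonneg P.σ]
        have : 0 ≤ w x / χ x * ((1 - u) * (χ x * P.μ - 1 / 2 * P.σ ^ 2 * (1 + u))) :=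
          mul_nonneg (by positivity) (mul_nonneg (by linarith [hu.2]) (by linarith))
        linarith
  · refine strictMonoOn_of_hasDerivWithinAt_pos (f' := w) (convex_Ici 0) hcont ?_ ?_
    · intro x hx
      rw [interior_Ici] at hx ⊢
      exact (h.hasDerivAt hx).1.hasDerivWithinAt
    · exact fun x hx => h.w_pos x (interior_subset hx)
  · refine AntitoneOn.concaveOn_of_deriv (convex_Ici 0) hcont ?_ ?_
    · intro x hx
      rw [interior_Ici] at hx
      exact (h.hasDerivAt hx).1.differentiableAt.differentiableWithinAt
    · rw [interior_Ici]
      exact (h.w_anti.antitoneOn.mono Ioi_subset_Ici_self).congr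
        fun x hx => (h.hasDerivAt hx).1.deriv.symm
  · intro x hx
    rw [h.deriv_deriv hx]
    exact neg_neg_of_pos (div_pos (h.w_pos x hx.le) (h.χ_pos x hx.le))
  · have : EqOn (fun x => deriv v x / deriv (deriv v) x) (fun x => -χ x) (Ioi 0) := by
      intro x hx
      have hw := (h.w_pos x (mem_Ioi.mp hx).le).ne'
      simp only
      rw [(h.hasDerivAt hx).1.deriv, h.deriv_deriv hx]
      field_simp
    refine StrictAntiOn.congr ?_ this.symm
    exact fun x hx y hy hxy => neg_lt_neg (h.χ_mono (mem_Ioi.mp hx).le (mem_Ioi.mp hy).le hxy)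

/-! ### Standing assumptions -/

/-- The standing assumptions on the parameters and the payout intensity. -/
structure Admissible (P : Params) (γ : ℝ) : Prop where
  hη : 0 < P.η
  hημ : P.η < P.μ
  hμη : P.μ < 2 * P.η
  hσ : 0 < P.σ
  hδ : 0 < P.δ
  hγ : 0 < γ

namespace Admissible

variable {P : Params} {γ : ℝ}

theorem hμ (h : Admissible P γ) : 0 < P.μ := h.hη.trans h.hημ

theorem etaBar_pos (h : Admissible P γ) : 0 < etaBar P := by
  have := h.hμ
  have := h.hσ
  unfold etaBar
  positivity

theorem shape_pos (h : Admissible P γ) : 0 < etaBar P * (P.δ + γ) + 1 := by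
  have := h.etaBar_pos
  have := h.hδ
  have := h.hγ
  positivity

theorem loading_pos (h : Admissible P γ) : 0 < etaBar P * (P.μ - P.η) :=
  mul_pos h.etaBar_pos (sub_pos.mpr h.hημ)

end Admissible

/-! ### The gamma law -/

variable {P : Params} {γ k β : ℝ}

theorem g_eq (P : Params) (γ : ℝ) {y : ℝ} (hy : 0 < y) :
    g P γ y = (γ * etaBar P) ^ (etaBar P * (P.δ + γ) + 1) / Real.Gamma (etaBar P * (P.δ + γ) + 1)
      * y ^ (etaBar P * (P.δ + γ)) * Real.exp (-(γ * etaBar P * y)) := by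
  rw [g, ProbabilityTheory.gammaPDFReal, if_pos hy.le, add_sub_cancel_right]

theorem g_pos (h : Admissible P γ) {y : ℝ} (hy : 0 < y) : 0 < g P γ y :=
  ProbabilityTheory.gammaPDFReal_pos h.shape_pos (mul_pos h.hγ h.etaBar_pos) hy

theorem hasDerivAt_g (P : Params) (γ : ℝ) {y : ℝ} (hy : 0 < y) :
    HasDerivAt (g P γ) (g P γ y * (etaBar P * (P.δ + γ) / y - γ * etaBar P)) y := by
  have h1 : HasDerivAt (fun y : ℝ => y ^ (etaBar P * (P.δ + γ)))
      (etaBar P * (P.δ + γ) * y ^ (etaBar P * (P.δ + γ) - 1)) y :=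
    Real.hasDerivAt_rpow_const (Or.inl hy.ne')
  have h2 : HasDerivAt (fun y : ℝ => Real.exp (-(γ * etaBar P * y)))
      (Real.exp (-(γ * etaBar P * y)) * (-(γ * etaBar P))) y := by
    simpa using (((hasDerivAt_id y).const_mul (γ * etaBar P)).neg).exp
  have h3 := ((h1.const_mul ((γ * etaBar P) ^ (etaBar P * (P.δ + γ) + 1)
    / Real.Gamma (etaBar P * (P.δ + γ) + 1))).mul h2)
  refine (h3.congr_of_eventuallyEq
    (Filter.eventually_of_mem (Ioi_mem_nhds hy) fun x hx => g_eq P γ hx)).congr_deriv ?_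
  rw [g_eq P γ hy, Real.rpow_sub_one hy.ne']
  field_simp
  ring

theorem continuousOn_g (P : Params) (γ : ℝ) : ContinuousOn (g P γ) (Ioi 0) :=
  fun _ hy => (hasDerivAt_g P γ hy).continuousAt.continuousWithinAt

theorem hasDerivAt_integral {f : ℝ → ℝ} (hf : ContinuousOn f (Ioi 0)) {a y : ℝ} (ha : 0 < a)
    (hy : 0 < y) : HasDerivAt (fun z => ∫ s in a..z, f s) (f y) y := by
  refine intervalIntegral.integral_hasDerivAt_right ?_ ?_ (hf.continuousAt (Ioi_mem_nhds hy))
  · exact (hf.mono fun s hs => (lt_min ha hy).trans_le hs.1).intervalIntegrable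
  · exact hf.stronglyMeasurableAtFilter isOpen_Ioi y hy

theorem hasDerivAt_G (h : Admissible P γ) {y : ℝ} (hy : 0 < y) :
    HasDerivAt (G P γ) (g P γ y) y := by
  have hr := mul_pos h.hγ h.etaBar_pos
  have hint : MeasureTheory.Integrable (g P γ) := by
    change MeasureTheory.Integrable (ProbabilityTheory.gammaPDFReal _ _)
    refine ⟨(ProbabilityTheory.measurable_gammaPDFReal _ _).aestronglyMeasurable, ?_⟩
    rw [MeasureTheory.hasFiniteIntegral_iff_ofReal (Filter.Eventually.of_forall fun x =>
      ProbabilityTheory.gammaPDFReal_nonneg h.shape_pos hr x)]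
    exact (ProbabilityTheory.lintegral_gammaPDF_eq_one h.shape_pos hr).trans_lt ENNReal.one_lt_top
  have hG : ∀ z, G P γ z = (∫ s in Iic y, g P γ s) + ∫ s in y..z, g P γ s := by
    intro z
    rw [G, ProbabilityTheory.cdf_gammaMeasure_eq_integral h.shape_pos hr,
      ← intervalIntegral.integral_Iic_sub_Iic hint.integrableOn hint.integrableOn]
    simp only [g]
    ring
  rw [funext hG]
  exact (hasDerivAt_integral (continuousOn_g P γ) hy hy).const_add _

theorem hasDerivAt_H (h : Admissible P γ) (β : ℝ) {y : ℝ} (hy : 0 < y) :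
    HasDerivAt (H P γ β) (1 / (y ^ 2 * g P γ y)) y :=
  hasDerivAt_integral (f := fun y => 1 / (y ^ 2 * g P γ y))
    (continuousOn_const.div ((continuousOn_pow 2).mul (continuousOn_g P γ)) fun _ hs =>
      (mul_pos (pow_pos hs 2) (g_pos h hs)).ne') (Real.exp_pos _) hy

theorem H_exp_neg (P : Params) (γ β : ℝ) : H P γ β (Real.exp (-β)) = 0 :=
  intervalIntegral.integral_same

theorem fBar_exp_neg (P : Params) (γ k β : ℝ) : fBar P γ k β (Real.exp (-β)) = 0 := by
  simp [fBar, H]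

theorem hasDerivAt_fBar (h : Admissible P γ) (k β : ℝ) {y : ℝ} (hy : 0 < y) :
    HasDerivAt (fBar P γ k β) (g P γ y * (k - etaBar P * (P.μ - P.η) * H P γ β y)) y := by
  have hG := hasDerivAt_G h hy
  have hint : HasDerivAt (fun z => ∫ s in Real.exp (-β)..z, G P γ s / (s ^ 2 * g P γ s))
      (G P γ y / (y ^ 2 * g P γ y)) y :=
    hasDerivAt_integral (f := fun s => G P γ s / (s ^ 2 * g P γ s))
      (ContinuousOn.div (fun s hs => (hasDerivAt_G h hs).continuousAt.continuousWithinAt)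
        ((continuousOn_pow 2).mul (continuousOn_g P γ)) fun _ hs =>
        (mul_pos (pow_pos hs 2) (g_pos h hs)).ne') (Real.exp_pos _) hy
  refine (((hG.sub_const _).const_mul k).sub
    (((hG.mul (hasDerivAt_H h β hy)).sub hint).const_mul _)).congr_deriv ?_
  ring

/-! ### The risk tolerance between the payout level and the maximum-risk level -/

/-- The risk tolerance `-v'/v''` on the intermediate interval, as a function of `z = -log v'`. It
is the derivative of `z ↦ fBar P γ k β (e^z)`. -/
noncomputable def riskTol (P : Params) (γ k β z : ℝ) : ℝ :=
  Real.exp z * g P γ (Real.exp z) * (k - etaBar P * (P.μ - P.η) * H P γ β (Real.exp z))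

theorem hasDerivAt_fBar_exp (h : Admissible P γ) (k β z : ℝ) :
    HasDerivAt (fun z => fBar P γ k β (Real.exp z)) (riskTol P γ k β z) z := by
  refine ((hasDerivAt_fBar h k β (Real.exp_pos z)).comp z (Real.hasDerivAt_exp z)).congr_deriv ?_
  rw [riskTol]
  ring

/-- The linear equation `X' = (1 + η̄(δ + γ) - γη̄e^z) X - η̄(μ - η)` of the risk tolerance, which is
the HJB equation differentiated along `x ↦ -log v'(x)`. -/
theorem hasDerivAt_riskTol (h : Admissible P γ) (k β z : ℝ) :
    HasDerivAt (riskTol P γ k β) (riskTol P γ k β z *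
      (1 + etaBar P * (P.δ + γ) - γ * etaBar P * Real.exp z) - etaBar P * (P.μ - P.η)) z := by
  have hy := Real.exp_pos z
  have hg := g_pos h hy
  have he := Real.hasDerivAt_exp z
  have h1 := he.mul ((hasDerivAt_g P γ hy).comp z he)
  have h2 := (((hasDerivAt_H h β hy).comp z he).const_mul (etaBar P * (P.μ - P.η))).const_sub k
  refine (h1.mul h2).congr_deriv ?_
  simp only [riskTol, Function.comp_apply, Pi.mul_apply]
  field_simp
  ring

theorem continuous_riskTol (h : Admissible P γ) (k β : ℝ) : Continuous (riskTol P γ k β) :=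
  continuous_iff_continuousAt.mpr fun z => (hasDerivAt_riskTol h k β z).continuousAt

theorem middlePiece_eq (P : Params) (γ k β b vb z x : ℝ) :
    middlePiece P γ k β b vb z x = (Real.exp (-z) * (riskTol P γ k β z / etaBar P - (P.μ - P.η))
      + γ * (vb + x - b)) / (P.δ + γ) := by
  rw [middlePiece, riskTol]
  ring

theorem hasDerivAt_middlePiece (h : Admissible P γ) (k β b vb c z : ℝ) :
    HasDerivAt (fun z => middlePiece P γ k β b vb z (fBar P γ k β (Real.exp z) + c))
      (Real.exp (-z) * riskTol P γ k β z) z := by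
  have hn := h.etaBar_pos.ne'
  have hδγ := (add_pos h.hδ h.hγ).ne'
  simp only [middlePiece_eq]
  have he : HasDerivAt (fun z => Real.exp (-z)) (-Real.exp (-z)) z := by
    simpa using (hasDerivAt_neg z).exp
  have h1 := he.mul (((hasDerivAt_riskTol h k β z).div_const (etaBar P)).sub_const (P.μ - P.η))
  have h2 := ((((hasDerivAt_fBar_exp h k β z).add_const c).const_add vb).sub_const b).const_mul γ
  refine ((h1.add h2).div_const (P.δ + γ)).congr_deriv ?_
  have hexp : Real.exp (-z) * Real.exp z = 1 := by rw [← Real.exp_add]; simp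
  field_simp
  linear_combination (-γ * riskTol P γ k β z * etaBar P) * hexp

/-- If the risk tolerance is positive with positive derivative at `y = A`, then it is so at all
`y < A`: with `q = 1 + η̄(δ + γ) - γη̄y` the derivative has the sign of
`k - η̄(μ - η) H(y) - η̄(μ - η) / (q y g(y))`, which decreases in `y`. -/
theorem riskTol_deriv_pos (h : Admissible P γ) {A : ℝ} (hA : 0 < A)
    (hpos : 0 < riskTol P γ k β (Real.log A))
    (hd : etaBar P * (P.μ - P.η) < riskTol P γ k β (Real.log A) *
      (1 + etaBar P * (P.δ + γ) - γ * etaBar P * A)) {z : ℝ} (hz : z ≤ Real.log A) :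
    0 < riskTol P γ k β z ∧ etaBar P * (P.μ - P.η) < riskTol P γ k β z *
      (1 + etaBar P * (P.δ + γ) - γ * etaBar P * Real.exp z) := by
  have hn := h.etaBar_pos
  have hl := h.loading_pos
  have hγ := h.hγ
  set c := etaBar P * (P.μ - P.η) with hc
  let q : ℝ → ℝ := fun y => 1 + etaBar P * (P.δ + γ) - γ * etaBar P * y
  have hqA : 0 < q A := by
    by_contra hneg
    have := mul_nonpos_of_nonneg_of_nonpos hpos.le (not_lt.mp hneg)
    simp only [q] at this
    linarith
  have hq : ∀ y ≤ A, 0 < q y := by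
    intro y hy
    have : γ * etaBar P * y ≤ γ * etaBar P * A := by gcongr
    simp only [q] at hqA ⊢
    linarith
  let Φ : ℝ → ℝ := fun y => k - c * H P γ β y - c / (q y * (y * g P γ y))
  have hΦ : ∀ y ∈ Ioc 0 A, HasDerivAt Φ
      (-(c * (γ * etaBar P) / (q y ^ 2 * (y * g P γ y)))) y := by
    intro y hy
    have hgy := g_pos h hy.1
    have hqy := hq y hy.2
    have hy0 := hy.1
    have e1 : HasDerivAt q (-(γ * etaBar P)) y := by
      simpa using ((hasDerivAt_id y).const_mul (γ * etaBar P)).const_sub (1 + etaBar P * (P.δ + γ))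
    have e2 := e1.mul ((hasDerivAt_id y).mul (hasDerivAt_g P γ hy.1))
    have e3 := (hasDerivAt_const y c).div e2 (mul_pos hqy (mul_pos hy0 hgy)).ne'
    refine ((((hasDerivAt_H h β hy.1).const_mul c).const_sub k).sub e3).congr_deriv ?_
    simp only [Pi.mul_apply, id_eq]
    field_simp
    simp only [q]
    ring
  have hanti : AntitoneOn Φ (Ioc 0 A) := by
    refine antitoneOn_of_hasDerivWithinAt_nonpos (convex_Ioc 0 A)
      (fun y hy => (hΦ y hy).continuousAt.continuousWithinAt)
      (fun y hy => (hΦ y (interior_subset hy)).hasDerivWithinAt) ?_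
    intro y hy
    have hy' := interior_subset hy
    have := g_pos h hy'.1
    have := hy'.1
    exact neg_nonpos.mpr (by positivity)
  have hrel : ∀ z, Real.exp z ≤ A → riskTol P γ k β z * q (Real.exp z) - c =
      (q (Real.exp z) * (Real.exp z * g P γ (Real.exp z))) * Φ (Real.exp z) := by
    intro z hz
    have := hq _ hz
    have := g_pos h (Real.exp_pos z)
    simp only [Φ, riskTol]
    rw [← hc]
    field_simp
  have hexpA := Real.exp_log hA
  have hzA : Real.exp z ≤ A := (Real.exp_le_exp.mpr hz).trans_eq hexpA
  have hw : ∀ z, Real.exp z ≤ A → 0 < q (Real.exp z) * (Real.exp z * g P γ (Real.exp z)) :=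
    fun z hz => mul_pos (hq _ hz) (mul_pos (Real.exp_pos z) (g_pos h (Real.exp_pos z)))
  have hΦA : 0 < Φ A := by
    have e := hrel _ hexpA.le
    have w := hw _ hexpA.le
    rw [hexpA] at e w
    have : 0 < q A * (A * g P γ A) * Φ A := by rw [← e]; exact sub_pos.mpr hd
    exact pos_of_mul_pos_right this w.le
  have hΦz : 0 < Φ (Real.exp z) :=
    hΦA.trans_le (hanti ⟨Real.exp_pos z, hzA⟩ ⟨hA, le_rfl⟩ hzA)
  have key : 0 < riskTol P γ k β z * q (Real.exp z) - c := by
    rw [hrel z hzA]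
    exact mul_pos (hw z hzA) hΦz
  refine ⟨?_, sub_pos.mp key⟩
  exact pos_of_mul_pos_left (hl.trans (sub_pos.mp key)) (hq _ hzA).le

theorem strictMonoOn_riskTol (h : Admissible P γ) {A : ℝ} (hA : 0 < A)
    (hpos : 0 < riskTol P γ k β (Real.log A))
    (hd : etaBar P * (P.μ - P.η) < riskTol P γ k β (Real.log A) *
      (1 + etaBar P * (P.δ + γ) - γ * etaBar P * A)) :
    StrictMonoOn (riskTol P γ k β) (Iic (Real.log A)) := by
  refine strictMonoOn_of_hasDerivWithinAt_pos (convex_Iic _)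
    (continuous_riskTol h k β).continuousOn
    (fun z _ => (hasDerivAt_riskTol h k β z).hasDerivWithinAt) ?_
  exact fun z hz => sub_pos.mpr (riskTol_deriv_pos h hA hpos hd (mem_Iic.mp (interior_subset hz))).2

/-! ### The constants -/

theorem lam_spec (h : Admissible P γ) :
    lam P γ < 0 ∧ P.σ ^ 2 / 2 * lam P γ ^ 2 + P.η * lam P γ - (P.δ + γ) = 0 :=
  (eq_lam_iff P γ h.hη h.hσ (add_pos h.hδ h.hγ) _).mp rfl

theorem f1_eq (h : Admissible P γ) :
    f1 P γ = P.σ ^ 2 * lam P γ / (2 * (P.δ + γ)) + P.η / P.δ := by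
  obtain ⟨hneg, hq⟩ := lam_spec h
  have hδ := h.hδ
  have hδγ := add_pos h.hδ h.hγ
  have hne := hneg.ne
  rw [f1]
  field_simp
  linear_combination -2 * hq * P.δ

/-- The point `γ₁` in closed form. -/
theorem gamma1_eq (hη : 0 < P.η) (hημ : P.η < P.μ) (hμη : P.μ < 2 * P.η) (hσ : 0 < P.σ)
    (hδ : 0 < P.δ) : gamma1 P = etaBar P * P.δ ^ 2 + 2 * P.η * P.δ / P.μ - P.δ := by
  have hμ := hη.trans hημ
  set γ₁ := etaBar P * P.δ ^ 2 + 2 * P.η * P.δ / P.μ - P.δ with hγ₁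
  have hpos : 0 < γ₁ := by
    have h1 : 0 < etaBar P * P.δ ^ 2 := by unfold etaBar; positivity
    have h2 : P.δ < 2 * P.η * P.δ / P.μ := by rw [lt_div_iff₀ hμ]; nlinarith
    linarith
  have hlam : lam P γ₁ = -(P.μ * (P.δ + γ₁) / (P.σ ^ 2 * P.δ)) := by
    refine ((eq_lam_iff P γ₁ hη hσ (add_pos hδ hpos) _).mpr ⟨?_, ?_⟩).symm
    · have := add_pos hδ hpos
      exact neg_neg_of_pos (by positivity)
    · rw [hγ₁, etaBar]
      field_simp
      ring
  have hf1 : f1 P γ₁ = (2 * P.η - P.μ) / (2 * P.δ) := by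
    rw [f1_eq ⟨hη, hημ, hμη, hσ, hδ, hpos⟩, hlam]
    field_simp
    ring
  obtain ⟨hmem, heq⟩ := Function.invFunOn_pos (f := f1 P) (s := Ioi 0)
    ⟨γ₁, hpos, hf1⟩
  change gamma1 P ∈ Ioi 0 at hmem
  change f1 P (gamma1 P) = _ at heq
  have hadm : Admissible P (gamma1 P) := ⟨hη, hημ, hμη, hσ, hδ, hmem⟩
  obtain ⟨-, hq⟩ := lam_spec hadm
  have ht := add_pos hδ hadm.hγ
  rw [f1_eq hadm] at heq
  have hl : lam P (gamma1 P) = -(P.μ * (P.δ + gamma1 P) / (P.σ ^ 2 * P.δ)) := by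
    field_simp at heq ⊢
    linarith
  rw [hl] at hq
  rw [hγ₁, etaBar]
  field_simp at hq ⊢
  have := (mul_eq_zero.mp (hq.trans (mul_zero _))).resolve_left ht.ne'
  linarith

theorem alpha_eq (h : Admissible P γ) :
    alpha P γ = 1 + (P.δ + P.μ * P.η / P.σ ^ 2 + P.μ * lam P γ / 2) / γ := by
  obtain ⟨hneg, hq⟩ := lam_spec h
  have := h.hσ
  have := h.hγ
  have hne := hneg.ne
  rw [alpha]
  field_simp
  linear_combination (-2 * P.μ) * hq

theorem alpha_lt (h : Admissible P γ) : alpha P γ < (γ + P.δ) / γ := by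
  have hneg := (lam_spec h).1
  have hσ := h.hσ
  have hpos : 0 < (γ + P.δ) / γ := div_pos (add_pos h.hγ h.hδ) h.hγ
  have hμ : P.μ / (P.σ ^ 2 * lam P γ) < 0 :=
    div_neg_of_pos_of_neg h.hμ (mul_neg_of_pos_of_neg (by positivity) hneg)
  rw [alpha]
  nlinarith

/-- The condition `γ < γ₁` amounts to `α_γ > 1`. -/
theorem one_lt_alpha (h : Admissible P γ) (hγ₁ : γ < gamma1 P) : 1 < alpha P γ := by
  obtain ⟨hneg, hq⟩ := lam_spec h
  rw [gamma1_eq h.hη h.hημ h.hμη h.hσ h.hδ, etaBar] at hγ₁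
  have hμ := h.hμ
  have hσ := h.hσ
  have hδ := h.hδ
  have hs : 0 < P.σ ^ 2 := by positivity
  have hlam : lam P γ < -(P.μ * (P.δ + γ) / (P.σ ^ 2 * P.δ)) := by
    set ρ := -(P.μ * (P.δ + γ) / (P.σ ^ 2 * P.δ)) with hρ
    -- The quadratic with root `lam` is negative at `ρ`, hence `ρ` lies between its two roots.
    have hqρ : P.σ ^ 2 / 2 * ρ ^ 2 + P.η * ρ - (P.δ + γ) < 0 := by
      have e : P.σ ^ 2 / 2 * ρ ^ 2 + P.η * ρ - (P.δ + γ) = (P.δ + γ) *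
          (P.μ ^ 2 / (2 * P.σ ^ 2 * P.δ ^ 2)) *
          (γ - (2 * P.σ ^ 2 / P.μ ^ 2 * P.δ ^ 2 + 2 * P.η * P.δ / P.μ - P.δ)) := by
        rw [hρ]
        field_simp
        ring
      rw [e]
      exact mul_neg_of_pos_of_neg (mul_pos (add_pos hδ h.hγ) (by positivity))
        (sub_neg.mpr hγ₁)
    by_contra hle
    have hle := not_lt.mp hle
    have hvert : P.σ ^ 2 * lam P γ + P.η < 0 := by
      have : P.σ ^ 2 * lam P γ + P.η = -√(P.η ^ 2 + 2 * P.σ ^ 2 * (P.δ + γ)) := by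
        rw [lam]
        field_simp
        ring
      rw [this]
      have := add_pos hδ h.hγ
      exact neg_neg_of_pos (Real.sqrt_pos.mpr (by positivity))
    have h1 : P.σ ^ 2 / 2 * (ρ + lam P γ) + P.η ≤ 0 := by nlinarith
    have h2 : 0 ≤ (ρ - lam P γ) * (P.σ ^ 2 / 2 * (ρ + lam P γ) + P.η) :=
      mul_nonneg_of_nonpos_of_nonpos (sub_nonpos.mpr hle) h1
    nlinarith
  have h1 : -(P.δ / (γ + P.δ)) < P.μ / (P.σ ^ 2 * lam P γ) := by
    have hγδ := add_pos h.hγ hδ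
    have hl' : lam P γ * (P.σ ^ 2 * P.δ) < -(P.μ * (P.δ + γ)) := by
      have := mul_lt_mul_of_pos_right hlam (mul_pos hs hδ)
      rwa [neg_mul, div_mul_cancel₀ _ (mul_pos hs hδ).ne'] at this
    rw [← sub_pos]
    have e : P.μ / (P.σ ^ 2 * lam P γ) - -(P.δ / (γ + P.δ)) =
        (-(P.μ * (γ + P.δ)) - P.δ * (P.σ ^ 2 * lam P γ)) / ((P.σ ^ 2 * -lam P γ) * (γ + P.δ)) := by
      have := hneg.ne
      field_simp
      ring
    rw [e]
    exact div_pos (by linarith) (mul_pos (mul_pos hs (neg_pos.mpr hneg)) hγδ)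
  have h2 : (γ + P.δ) / γ * (1 + -(P.δ / (γ + P.δ))) = 1 := by
    have := h.hγ
    field_simp
    ring
  rw [alpha]
  refine h2.symm.trans_lt (mul_lt_mul_of_pos_left (by linarith) ?_)
  exact div_pos (add_pos h.hγ hδ) h.hγ

theorem lam_anti {γ' : ℝ} (h : Admissible P γ) (hlt : γ < γ') : lam P γ' < lam P γ := by
  have hσ := h.hσ
  have := add_pos h.hδ h.hγ
  rw [lam, lam]
  gcongr

theorem alpha_anti {γ' : ℝ} (h : Admissible P γ) (h' : Admissible P γ') (hlt : γ < γ')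
    (hγ₁ : γ' < gamma1 P) : alpha P γ' < alpha P γ := by
  have hα := one_lt_alpha h' hγ₁
  have hμ := h.hμ
  have hγ := h.hγ
  have hl := lam_anti h hlt
  rw [alpha_eq h'] at hα ⊢
  rw [alpha_eq h]
  have hnum : 0 < (P.δ + P.μ * P.η / P.σ ^ 2 + P.μ * lam P γ' / 2) / γ' := by linarith
  have hnum' := pos_of_mul_pos_left (a := P.δ + P.μ * P.η / P.σ ^ 2 + P.μ * lam P γ' / 2)
    (b := γ'⁻¹) (by rwa [← div_eq_mul_inv]) (inv_nonneg.mpr h'.hγ.le)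
  have : (P.δ + P.μ * P.η / P.σ ^ 2 + P.μ * lam P γ' / 2) / γ' <
      (P.δ + P.μ * P.η / P.σ ^ 2 + P.μ * lam P γ' / 2) / γ :=
    div_lt_div_of_pos_left hnum' hγ hlt
  have h2 : (P.δ + P.μ * P.η / P.σ ^ 2 + P.μ * lam P γ' / 2) / γ <
      (P.δ + P.μ * P.η / P.σ ^ 2 + P.μ * lam P γ / 2) / γ := by gcongr
  linarith

/-- At the maximum-risk level the risk tolerance `σ²/μ` has positive derivative. -/
theorem loading_lt_at_alpha (h : Admissible P γ) :
    etaBar P * (P.μ - P.η) < P.σ ^ 2 / P.μ *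
      (1 + etaBar P * (P.δ + γ) - γ * etaBar P * alpha P γ) := by
  have hα := alpha_lt h
  rw [lt_div_iff₀ h.hγ] at hα
  have hμ := h.hμ
  have hσ := h.hσ
  have hn := h.etaBar_pos
  have h1 : etaBar P * (alpha P γ * γ) < etaBar P * (γ + P.δ) := by gcongr
  have h2 : etaBar P * (P.μ - P.η) < P.σ ^ 2 / P.μ * 1 := by
    have e : P.σ ^ 2 / P.μ * 1 = etaBar P * (P.μ / 2) := by rw [etaBar]; field_simp
    rw [e]
    exact mul_lt_mul_of_pos_left (by linarith [h.hμη]) hn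
  refine h2.trans (mul_lt_mul_of_pos_left ?_ (by positivity))
  linarith

theorem c32_neg (h : Admissible P γ) (hα : 0 < alpha P γ) : c32 P γ < 0 := by
  have := h.hμ
  have := h.hσ
  have := (lam_spec h).1.ne
  rw [c32]
  exact neg_neg_of_pos (by positivity)

theorem c32_mul_lam_sq (h : Admissible P γ) (hα : 0 < alpha P γ) :
    c32 P γ * lam P γ ^ 2 = -(P.μ / (P.σ ^ 2 * alpha P γ)) := by
  have := (lam_spec h).1.ne
  rw [c32]
  field_simp

/-- The defining property of `α_γ`: the slope of the last piece at the maximum-risk level. -/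
theorem c32_mul_lam (h : Admissible P γ) (hα : 0 < alpha P γ) :
    c32 P γ * lam P γ + γ / (γ + P.δ) = 1 / alpha P γ := by
  have := h.hσ
  have := h.hγ
  have := add_pos h.hγ h.hδ
  have hl := (lam_spec h).1.ne
  have e : alpha P γ * γ * (P.σ ^ 2 * lam P γ) = (γ + P.δ) * (P.σ ^ 2 * lam P γ + P.μ) := by
    rw [alpha]
    field_simp
  rw [c32]
  field_simp
  linear_combination e

/-! ### Monotonicity of `f₃ / f₄` -/

/-- The function `y ↦ g(1) / (y g(y))`. -/
noncomputable def gRatio (P : Params) (γ y : ℝ) : ℝ :=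
  Real.exp (etaBar P * γ * (y - 1)) / y ^ (etaBar P * (P.δ + γ) + 1)

/-- The quotient `f₃ / f₄` with `α_γ` replaced by a free variable `A`. -/
noncomputable def f3Ratio (P : Params) (γ A : ℝ) : ℝ :=
  P.μ / (2 * (P.μ - P.η)) * gRatio P γ A + ∫ y in (1 : ℝ)..A, gRatio P γ y / y

theorem gRatio_pos (P : Params) (γ : ℝ) {y : ℝ} (hy : 0 < y) : 0 < gRatio P γ y := by
  rw [gRatio]
  positivity

theorem gRatio_eq (h : Admissible P γ) {y : ℝ} (hy : 0 < y) :
    gRatio P γ y = g P γ 1 / (y * g P γ y) := by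
  have := h.hγ
  have := h.etaBar_pos
  have hG := Real.Gamma_pos_of_pos h.shape_pos
  rw [gRatio, g_eq P γ one_pos, g_eq P γ hy, Real.one_rpow, Real.rpow_add_one hy.ne',
    show etaBar P * γ * (y - 1) = -(γ * etaBar P * 1) - -(γ * etaBar P * y) by ring, Real.exp_sub]
  field_simp

theorem hasDerivAt_gRatio (P : Params) (γ : ℝ) {y : ℝ} (hy : 0 < y) :
    HasDerivAt (gRatio P γ)
      (gRatio P γ y / y * (etaBar P * γ * y - etaBar P * (P.δ + γ) - 1)) y := by
  have h1 : HasDerivAt (fun y => Real.exp (etaBar P * γ * (y - 1)))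
      (Real.exp (etaBar P * γ * (y - 1)) * (etaBar P * γ)) y := by
    simpa using (((hasDerivAt_id y).sub_const 1).const_mul (etaBar P * γ)).exp
  have h2 : HasDerivAt (fun y : ℝ => y ^ (etaBar P * (P.δ + γ) + 1))
      ((etaBar P * (P.δ + γ) + 1) * y ^ (etaBar P * (P.δ + γ) + 1 - 1)) y :=
    Real.hasDerivAt_rpow_const (Or.inl hy.ne')
  refine (h1.div h2 (Real.rpow_pos_of_pos hy _).ne').congr_deriv ?_
  rw [gRatio, Real.rpow_sub_one hy.ne']
  field_simp
  ring

theorem continuousOn_gRatio_div (P : Params) (γ : ℝ) :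
    ContinuousOn (fun y => gRatio P γ y / y) (Ioi 0) :=
  ContinuousOn.div (fun _ hy => (hasDerivAt_gRatio P γ hy).continuousAt.continuousWithinAt)
    continuousOn_id fun _ hy => (mem_Ioi.mp hy).ne'

/-- The quotient of `f₃` and `f₄` is `f3Ratio` at `A = α_γ`. -/
theorem f3_eq (h : Admissible P γ) (hα : 1 < alpha P γ) :
    f3 P γ = f4 P γ * f3Ratio P γ (alpha P γ) := by
  have hα0 := one_pos.trans hα
  have hμη := sub_pos.mpr h.hημ
  have hμ := h.hμ
  have hint : ∫ y in (1 : ℝ)..alpha P γ,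
      Real.exp (etaBar P * γ * y) / y ^ (etaBar P * (P.δ + γ) + 2) =
      Real.exp (etaBar P * γ) * ∫ y in (1 : ℝ)..alpha P γ, gRatio P γ y / y := by
    rw [← intervalIntegral.integral_const_mul]
    refine intervalIntegral.integral_congr fun y hy => ?_
    rw [uIcc_of_le hα.le] at hy
    have hy0 : 0 < y := one_pos.trans_le hy.1
    simp only [gRatio]
    rw [show etaBar P * (P.δ + γ) + 2 = etaBar P * (P.δ + γ) + 1 + 1 by ring,
      Real.rpow_add_one hy0.ne',
      show etaBar P * γ * y = etaBar P * γ + etaBar P * γ * (y - 1) by ring, Real.exp_add]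
    field_simp
  rw [f3, f4, f3Ratio, hint, gRatio,
    show etaBar P * γ * alpha P γ = etaBar P * γ + etaBar P * γ * (alpha P γ - 1) by ring,
    Real.exp_add]
  have e : P.σ ^ 2 = etaBar P * P.μ ^ 2 / 2 := by rw [etaBar]; field_simp
  rw [e]
  field_simp

/-- The risk tolerance at `z = 0` compared with the value `η̄(μ - η)` it would have at payout level
zero. -/
theorem g_one_mul_c31 (h : Admissible P γ) (hα : 1 < alpha P γ) :
    g P γ 1 * c31 P γ 0 = etaBar P * (P.μ - P.η) * f3Ratio P γ (alpha P γ) := by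
  have hα0 := one_pos.trans hα
  have hμη := sub_pos.mpr h.hημ
  have hμ := h.hμ
  have hint : ∫ y in (1 : ℝ)..alpha P γ, gRatio P γ y / y = g P γ 1 * H P γ 0 (alpha P γ) := by
    rw [H, neg_zero, Real.exp_zero, ← intervalIntegral.integral_const_mul]
    refine intervalIntegral.integral_congr fun y hy => ?_
    rw [uIcc_of_le hα.le] at hy
    have hy0 : 0 < y := one_pos.trans_le hy.1
    rw [gRatio_eq h hy0]
    field_simp
  have e : P.σ ^ 2 = etaBar P * P.μ ^ 2 / 2 := by rw [etaBar]; field_simp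
  rw [c31, f3Ratio, hint, gRatio_eq h hα0, e]
  field_simp

/-- The derivative in `A` has the sign of `B (γη̄A - η̄(δ + γ) - 1) + 1` with `B = μ / (2(μ - η)) > 1`,
and `γA < δ + γ` up to `A = α_γ`. -/
theorem f3Ratio_anti (h : Admissible P γ) :
    StrictAntiOn (f3Ratio P γ) (Icc 1 (alpha P γ)) := by
  have hB : 1 < P.μ / (2 * (P.μ - P.η)) := by
    have := h.hμη
    rw [one_lt_div (by linarith [h.hημ])]
    linarith
  have hd : ∀ A ∈ Icc 1 (alpha P γ), HasDerivAt (f3Ratio P γ)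
      (gRatio P γ A / A * (P.μ / (2 * (P.μ - P.η)) *
        (etaBar P * γ * A - etaBar P * (P.δ + γ) - 1) + 1)) A := by
    intro A hA
    have hA0 : 0 < A := one_pos.trans_le hA.1
    refine (((hasDerivAt_gRatio P γ hA0).const_mul (P.μ / (2 * (P.μ - P.η)))).add
      (hasDerivAt_integral (continuousOn_gRatio_div P γ) one_pos hA0)).congr_deriv ?_
    ring
  refine strictAntiOn_of_hasDerivWithinAt_neg (convex_Icc _ _)
    (fun A hA => (hd A hA).continuousAt.continuousWithinAt)
    (fun A hA => (hd A (interior_subset hA)).hasDerivWithinAt) ?_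
  intro A hA
  have hA' := interior_subset hA
  have hA0 : 0 < A := one_pos.trans_le hA'.1
  have hlt := hA'.2.trans_lt (alpha_lt h)
  rw [lt_div_iff₀ h.hγ] at hlt
  have h1 : etaBar P * (A * γ) < etaBar P * (γ + P.δ) := mul_lt_mul_of_pos_left hlt h.etaBar_pos
  refine mul_neg_of_pos_of_neg (div_pos (gRatio_pos P γ hA0) hA0) ?_
  nlinarith

/-- Monotonicity in `γ`, from `log y ≤ y - 1`. -/
theorem gRatio_mono {γ' : ℝ} (h : Admissible P γ) (hle : γ ≤ γ') {y : ℝ} (hy : 1 ≤ y) :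
    gRatio P γ y ≤ gRatio P γ' y := by
  have hy0 := one_pos.trans_le hy
  have key : ∀ γ, gRatio P γ y = Real.exp (etaBar P * (y - 1 - Real.log y) * γ
      - Real.log y * (etaBar P * P.δ + 1)) := by
    intro γ
    rw [gRatio, Real.rpow_def_of_pos hy0, ← Real.exp_sub]
    ring_nf
  rw [key, key]
  have : 0 ≤ etaBar P * (y - 1 - Real.log y) :=
    mul_nonneg h.etaBar_pos.le (by linarith [Real.log_le_sub_one_of_pos hy0])
  gcongr

/-- The quotient `f₃ / f₄` is strictly increasing on `(0, γ₁)`: it decreases in `A`, while `α_γ`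
decreases in `γ`, and it increases in `γ` for fixed `A`. -/
theorem f3Ratio_lt {γ' : ℝ} (h : Admissible P γ) (h' : Admissible P γ') (hlt : γ < γ')
    (hγ₁ : γ' < gamma1 P) :
    f3Ratio P γ (alpha P γ) < f3Ratio P γ' (alpha P γ') := by
  have hα' := one_lt_alpha h' hγ₁
  have hαα := alpha_anti h h' hlt hγ₁
  refine (f3Ratio_anti h ⟨hα'.le, hαα.le⟩ ⟨(hα'.trans hαα).le, le_rfl⟩ hαα).trans_le ?_
  have hint : ∀ γ, IntervalIntegrable (fun y => gRatio P γ y / y) MeasureTheory.volume 1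
      (alpha P γ') := fun γ => ((continuousOn_gRatio_div P γ).mono fun s hs => by
    rw [uIcc_of_le hα'.le] at hs
    exact one_pos.trans_le hs.1).intervalIntegrable
  have hB : 0 ≤ P.μ / (2 * (P.μ - P.η)) := by
    have := h.hμ
    have := sub_pos.mpr h.hημ
    positivity
  refine add_le_add (mul_le_mul_of_nonneg_left (gRatio_mono h hlt.le hα'.le) hB) ?_
  refine intervalIntegral.integral_mono_on hα'.le (hint γ) (hint γ') fun y hy => ?_
  have hy0 : 0 < y := one_pos.trans_le hy.1
  have := gRatio_mono h hlt.le hy.1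
  gcongr

theorem f3Ratio_eq_one (h : Admissible P γ) (hγ₁ : γ < gamma1 P) (hf : f3 P γ = f4 P γ) :
    f3Ratio P γ (alpha P γ) = 1 := by
  rw [f3_eq h (one_lt_alpha h hγ₁)] at hf
  have : f4 P γ ≠ 0 := (mul_pos h.loading_pos (Real.exp_pos _)).ne'
  exact mul_left_cancel₀ this (hf.trans (mul_one _).symm)

/-! ### The solution beyond the payout level -/

/-- The derivative of the last piece of the solution. -/
noncomputable def lastSlope (P : Params) (γ xb x : ℝ) : ℝ :=
  c32 P γ * lam P γ * Real.exp (lam P γ * (x - xb)) + γ / (γ + P.δ)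

/-- The risk tolerance of the last piece of the solution. -/
noncomputable def lastTol (P : Params) (γ xb x : ℝ) : ℝ :=
  -(lastSlope P γ xb x / (c32 P γ * lam P γ ^ 2 * Real.exp (lam P γ * (x - xb))))

theorem lastSlope_self (h : Admissible P γ) (hα : 0 < alpha P γ) (xb : ℝ) :
    lastSlope P γ xb xb = 1 / alpha P γ := by
  rw [lastSlope, sub_self, mul_zero, Real.exp_zero, mul_one, c32_mul_lam h hα]

theorem lastTol_self (h : Admissible P γ) (hα : 0 < alpha P γ) (xb : ℝ) :
    lastTol P γ xb xb = P.σ ^ 2 / P.μ := by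
  rw [lastTol, lastSlope_self h hα, sub_self, mul_zero, Real.exp_zero, mul_one,
    c32_mul_lam_sq h hα]
  field_simp

theorem lastSlope_div_lastTol {xb x : ℝ} (hw : lastSlope P γ xb x ≠ 0) :
    -(lastSlope P γ xb x / lastTol P γ xb x) =
      c32 P γ * lam P γ ^ 2 * Real.exp (lam P γ * (x - xb)) := by
  rw [lastTol]
  field_simp

theorem lastSlope_pos (h : Admissible P γ) (hα : 0 < alpha P γ) (xb x : ℝ) :
    0 < lastSlope P γ xb x :=
  add_pos (mul_pos (mul_pos_of_neg_of_neg (c32_neg h hα) (lam_spec h).1) (Real.exp_pos _))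
    (div_pos h.hγ (add_pos h.hγ h.hδ))

theorem hasDerivAt_exp_lam (P : Params) (γ xb x : ℝ) :
    HasDerivAt (fun x => Real.exp (lam P γ * (x - xb)))
      (Real.exp (lam P γ * (x - xb)) * lam P γ) x := by
  simpa using (((hasDerivAt_id x).sub_const xb).const_mul (lam P γ)).exp

theorem isValueCurve_lastPiece (h : Admissible P γ) (hα : 0 < alpha P γ) (b vb xb : ℝ) :
    IsValueCurve (lastPiece P γ b vb xb) (lastSlope P γ xb) (lastTol P γ xb) (Ici xb) := by
  have hc := c32_neg h hα
  have hl := (lam_spec h).1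
  have hcl : c32 P γ * lam P γ ^ 2 < 0 := mul_neg_of_neg_of_pos hc (sq_pos_of_neg hl)
  have hκ : 0 < γ / (γ + P.δ) := div_pos h.hγ (add_pos h.hγ h.hδ)
  refine ⟨fun x _ => ?_, fun x _ => ?_, fun x _ => lastSlope_pos h hα xb x, fun x _ => ?_, ?_, ?_⟩
  · have h1 := (hasDerivAt_exp_lam P γ xb x).const_mul (c32 P γ)
    have h2 := ((((hasDerivAt_id x).sub_const b).add_const vb).add_const
      (P.η / (P.δ + γ))).const_mul (γ / (γ + P.δ))
    refine ((h1.add h2).congr_deriv ?_).hasDerivWithinAt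
    rw [lastSlope]
    ring
  · rw [lastSlope_div_lastTol (lastSlope_pos h hα xb x).ne']
    refine ((((hasDerivAt_exp_lam P γ xb x).const_mul (c32 P γ * lam P γ)).add_const
      (γ / (γ + P.δ))).congr_deriv ?_).hasDerivWithinAt
    ring
  · exact neg_pos.mpr (div_neg_of_pos_of_neg (lastSlope_pos h hα xb x)
      (mul_neg_of_neg_of_pos hcl (Real.exp_pos _)))
  · refine (ContinuousOn.div ?_ ?_ fun x _ =>
      (mul_neg_of_neg_of_pos hcl (Real.exp_pos _)).ne).neg
    · unfold lastSlope
      fun_prop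
    · fun_prop
  · have e : ∀ x, lastTol P γ xb x = -(1 / lam P γ)
        + γ / (γ + P.δ) / -(c32 P γ * lam P γ ^ 2) * Real.exp (-lam P γ * (x - xb)) := by
      intro x
      have := hc.ne
      rw [lastTol, lastSlope, neg_mul, Real.exp_neg]
      field_simp
      ring
    intro x _ y _ hxy
    rw [e, e]
    have : 0 < -(c32 P γ * lam P γ ^ 2) := neg_pos.mpr hcl
    have : 0 < -lam P γ := neg_pos.mpr hl
    gcongr

/-- The HJB equation of the last piece, with full retention and payout down to `b`. -/
theorem lastPiece_hjb (h : Admissible P γ) (hα : 0 < alpha P γ) (b vb xb x : ℝ) :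
    1 / 2 * P.σ ^ 2 * (-(lastSlope P γ xb x / lastTol P γ xb x)) + P.η * lastSlope P γ xb x
      - P.δ * lastPiece P γ b vb xb x + γ * (x - b + vb - lastPiece P γ b vb xb x) = 0 := by
  have hq := (lam_spec h).2
  have := add_pos h.hγ h.hδ
  have := add_pos h.hδ h.hγ
  rw [lastSlope_div_lastTol (lastSlope_pos h hα xb x).ne', lastSlope, lastPiece]
  field_simp
  linear_combination (2 * (P.δ + γ) ^ 2 * c32 P γ * Real.exp (lam P γ * (x - xb))) * hq

/-- The HJB equation of the intermediate piece, with the interior optimal retention and payout down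
to `b`; it determines the value from `z` and the risk tolerance. -/
theorem middlePiece_hjb (h : Admissible P γ) (k β b vb z x : ℝ) :
    Real.exp (-z) * (riskTol P γ k β z / etaBar P - (P.μ - P.η))
      - P.δ * middlePiece P γ k β b vb z x + γ * (x - b + vb - middlePiece P γ k β b vb z x)
      = 0 := by
  have := add_pos h.hδ h.hγ
  rw [middlePiece_eq]
  field_simp
  ring

/-- The two pieces meet at the maximum-risk level, because both satisfy the HJB equation there with
the same slope `1/α_γ` and the same risk tolerance `σ²/μ`. -/
theorem middlePiece_eq_lastPiece (h : Admissible P γ) (hα : 0 < alpha P γ) {k β : ℝ}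
    (htol : riskTol P γ k β (Real.log (alpha P γ)) = P.σ ^ 2 / P.μ) (b vb xb : ℝ) :
    middlePiece P γ k β b vb (Real.log (alpha P γ)) xb = lastPiece P γ b vb xb xb := by
  have hδγ := add_pos h.hδ h.hγ
  have e1 := middlePiece_hjb h k β b vb (Real.log (alpha P γ)) xb
  have e2 := lastPiece_hjb h hα b vb xb xb
  have hσ := h.hσ
  rw [htol, Real.exp_neg, Real.exp_log hα, etaBar] at e1
  rw [lastSlope_self h hα, lastTol_self h hα] at e2
  have e3 : (alpha P γ)⁻¹ * (P.σ ^ 2 / P.μ / (2 * P.σ ^ 2 / P.μ ^ 2) - (P.μ - P.η)) =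
      1 / 2 * P.σ ^ 2 * (-(1 / alpha P γ / (P.σ ^ 2 / P.μ))) + P.η * (1 / alpha P γ) := by
    field_simp
    ring
  rw [e3] at e1
  have : (P.δ + γ) * (middlePiece P γ k β b vb (Real.log (alpha P γ)) xb
      - lastPiece P γ b vb xb xb) = 0 := by linear_combination e2 - e1
  exact sub_eq_zero.mp ((mul_eq_zero.mp this).resolve_left hδγ.ne')

/-- The intermediate and the last piece together form a value curve on `[b, ∞)`, as soon as the
risk tolerance is `σ²/μ` at the maximum-risk level. -/
theorem isValueCurve_tail {k β c m b vb xb : ℝ} {f : ℝ → ℝ} (h : Admissible P γ)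
    (hα : 1 < alpha P γ)
    (hf : ∀ z, f z = fBar P γ k β (Real.exp z) + c) (hm : m < Real.log (alpha P γ))
    (hfm : f m = b) (hxb : f (Real.log (alpha P γ)) = xb)
    (htol : riskTol P γ k β (Real.log (alpha P γ)) = P.σ ^ 2 / P.μ) :
    BijOn f (Icc m (Real.log (alpha P γ))) (Icc b xb) ∧ b < xb ∧
    Function.invFunOn f (Icc m (Real.log (alpha P γ))) b = m ∧
    Function.invFunOn f (Icc m (Real.log (alpha P γ))) xb = Real.log (alpha P γ) ∧
    IsValueCurve
      (fun x => if x ≤ xb then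
        middlePiece P γ k β b vb (Function.invFunOn f (Icc m (Real.log (alpha P γ))) x) x
        else lastPiece P γ b vb xb x)
      (fun x => if x ≤ xb then Real.exp (-Function.invFunOn f (Icc m (Real.log (alpha P γ))) x)
        else lastSlope P γ xb x)
      (fun x => if x ≤ xb then
        riskTol P γ k β (Function.invFunOn f (Icc m (Real.log (alpha P γ))) x)
        else lastTol P γ xb x) (Ici b) := by
  have hα0 := one_pos.trans hα
  have hμ := h.hμ
  have hσ := h.hσ
  have hpos : 0 < riskTol P γ k β (Real.log (alpha P γ)) := by rw [htol]; positivity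
  have hd := loading_lt_at_alpha h
  rw [← htol] at hd
  have hmono := (strictMonoOn_riskTol h hα0 hpos hd).mono
    (Icc_subset_Iic_self (a := m) (b := Real.log (alpha P γ)))
  have hpos_m := (riskTol_deriv_pos h hα0 hpos hd hm.le).1
  have hfd : ∀ z ∈ Icc m (Real.log (alpha P γ)), HasDerivAt f (riskTol P γ k β z) z := by
    intro z _
    rw [funext hf]
    exact (hasDerivAt_fBar_exp h k β z).add_const c
  obtain ⟨hs, hbij⟩ := bijOn_of_deriv_pos hm.le hfd hmono.monotoneOn hpos_m
  have hlt := hs ⟨le_rfl, hm.le⟩ ⟨hm.le, le_rfl⟩ hm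
  have hcurve := isValueCurve_of_parametrization hm.le hfd
    (V := fun z => middlePiece P γ k β b vb z (f z))
    (fun z _ => by
      rw [funext hf]
      exact hasDerivAt_middlePiece h k β b vb c z)
    (continuous_riskTol h k β).continuousOn hmono hpos_m
  have hleft := hs.injOn.leftInvOn_invFunOn
  have hZm := hleft ⟨le_rfl, hm.le⟩
  have hZM := hleft ⟨hm.le, le_rfl⟩
  rw [hfm] at hZm hlt hbij hcurve
  rw [hxb] at hZM hlt hbij hcurve
  refine ⟨hbij, hlt, hZm, hZM, ?_⟩
  refine IsValueCurve.glue hlt.le (hcurve.congr ?_ (fun _ _ => rfl) (fun _ _ => rfl))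
    (isValueCurve_lastPiece h hα0 b vb xb) ?_ ?_ ?_
  · intro x hx
    simp only
    rw [hbij.surjOn.rightInvOn_invFunOn hx]
  · rw [hZM, middlePiece_eq_lastPiece h hα0 htol]
  · rw [hZM, lastSlope_self h hα0, Real.exp_neg, Real.exp_log hα0, one_div]
  · rw [hZM, htol, lastTol_self h hα0]

/-! ### Positive payout level -/

theorem riskTol_log_alpha_c31 (h : Admissible P γ) (hα : 0 < alpha P γ) :
    riskTol P γ (c31 P γ 0) 0 (Real.log (alpha P γ)) = P.σ ^ 2 / P.μ := by
  have := g_pos h hα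
  rw [riskTol, Real.exp_log hα, c31]
  field_simp
  ring

/-- The risk tolerance of the intermediate piece at the payout level `b > 0`, where `v' = 1`. -/
theorem riskTol_zero (P : Params) (γ : ℝ) :
    riskTol P γ (c31 P γ 0) 0 0 = g P γ 1 * c31 P γ 0 := by
  have := H_exp_neg P γ 0
  rw [neg_zero, Real.exp_zero] at this
  rw [riskTol, Real.exp_zero, this]
  ring

theorem Admissible.disc_pos (h : Admissible P γ) : 0 < 1 + P.δ * etaBar P :=
  add_pos one_pos (mul_pos h.hδ h.etaBar_pos)

theorem c21_pos (h : Admissible P γ) : 0 < c21 P := div_pos h.loading_pos h.disc_pos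

/-- The number `M_γ` is positive as soon as the risk tolerance at the payout level exceeds its value
`η̄(μ - η)` at `x = 0`, and it is chosen so that `firstTol` and `riskTol` agree at `z = 0`. -/
theorem bigM_pos_and_exp (h : Admissible P γ)
    (hlt : etaBar P * (P.μ - P.η) < g P γ 1 * c31 P γ 0) :
    0 < bigM P γ ∧ c21 P * (P.δ * etaBar P * Real.exp ((1 + P.δ * etaBar P) * bigM P γ) + 1) =
      g P γ 1 * c31 P γ 0 := by
  have hc := c21_pos h
  have hD := h.disc_pos
  have hn := h.etaBar_pos
  have hδ := h.hδ
  have h1 : 1 + P.δ * etaBar P < g P γ 1 / c21 P * c31 P γ 0 := by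
    rw [div_mul_eq_mul_div, lt_div_iff₀ hc, c21, mul_div_cancel₀ _ hD.ne']
    exact hlt
  have h2 : 1 < 1 / (P.δ * etaBar P) * (g P γ 1 / c21 P * c31 P γ 0 - 1) := by
    rw [div_mul_eq_mul_div, one_mul, one_lt_div (by positivity)]
    linarith
  refine ⟨mul_pos (by positivity) (Real.log_pos h2), ?_⟩
  rw [bigM, ← mul_assoc, mul_one_div_cancel hD.ne', one_mul, Real.exp_log (one_pos.trans h2)]
  field_simp
  ring

/-- The risk tolerance below the payout level, as a function of `z = -log v'`. -/
noncomputable def firstTol (P : Params) (γ z : ℝ) : ℝ :=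
  c21 P * (P.δ * etaBar P * Real.exp ((1 + P.δ * etaBar P) * (bigM P γ + z)) + 1)

theorem hasDerivAt_exp_bigM (P : Params) (γ z : ℝ) :
    HasDerivAt (fun z => Real.exp ((1 + P.δ * etaBar P) * (bigM P γ + z)))
      (Real.exp ((1 + P.δ * etaBar P) * (bigM P γ + z)) * (1 + P.δ * etaBar P)) z := by
  simpa using (((hasDerivAt_id z).const_add (bigM P γ)).const_mul (1 + P.δ * etaBar P)).exp

/-- The piece below the payout level, parametrized by `z ∈ [-M_γ, 0]`. -/
theorem isValueCurve_first (h : Admissible P γ)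
    (hlt : etaBar P * (P.μ - P.η) < g P γ 1 * c31 P γ 0) :
    BijOn (x1 P γ) (Icc (-bigM P γ) 0) (Icc 0 (bLevel P γ)) ∧ 0 < bLevel P γ ∧
    x1Inv P γ 0 = -bigM P γ ∧ x1Inv P γ (bLevel P γ) = 0 ∧
    IsValueCurve (firstPiece P γ) (fun x => Real.exp (-x1Inv P γ x))
      (fun x => firstTol P γ (x1Inv P γ x)) (Icc 0 (bLevel P γ)) := by
  have hc := c21_pos h
  have hn := h.etaBar_pos
  have hδ := h.hδ
  obtain ⟨hM, -⟩ := bigM_pos_and_exp h hlt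
  have hM' : -bigM P γ < 0 := neg_neg_of_pos hM
  have hfd : ∀ z, HasDerivAt (x1 P γ) (firstTol P γ z) z := by
    intro z
    have e : x1 P γ = fun z => k21 P * Real.exp ((1 + P.δ * etaBar P) * (bigM P γ + z))
        + c21 P * z + c21 P * (bigM P γ - P.δ * etaBar P / (1 + P.δ * etaBar P)) := by
      funext z
      rw [x1, add_comm z]
    rw [e]
    refine ((((hasDerivAt_exp_bigM P γ z).const_mul (k21 P)).add
      ((hasDerivAt_id z).const_mul (c21 P))).add_const _).congr_deriv ?_
    rw [firstTol, k21]
    field_simp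
  have hVd : ∀ z, HasDerivAt (fun z => c21 P * Real.exp (-z) *
      (Real.exp ((1 + P.δ * etaBar P) * (bigM P γ + z)) - 1))
      (Real.exp (-z) * firstTol P γ z) z := by
    intro z
    refine (((hasDerivAt_neg z).exp.const_mul (c21 P)).mul
      ((hasDerivAt_exp_bigM P γ z).sub_const 1)).congr_deriv ?_
    rw [firstTol]
    ring
  have hmono : StrictMono (firstTol P γ) := by
    intro x y hxy
    unfold firstTol
    gcongr
  have hpos : 0 < firstTol P γ (-bigM P γ) := by
    unfold firstTol
    positivity
  have hcont : Continuous (firstTol P γ) := by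
    unfold firstTol
    fun_prop
  have hx0 : x1 P γ (-bigM P γ) = 0 := by
    rw [x1, neg_add_cancel, mul_zero, Real.exp_zero, k21]
    ring
  have hxb : x1 P γ 0 = bLevel P γ := by
    rw [x1, bLevel, k21, zero_add, mul_comm (bigM P γ)]
    ring
  obtain ⟨hs, hbij⟩ := bijOn_of_deriv_pos hM'.le (fun z _ => hfd z)
    (hmono.monotone.monotoneOn _) hpos
  have hcurve := isValueCurve_of_parametrization hM'.le (fun z _ => hfd z) (fun z _ => hVd z)
    hcont.continuousOn (hmono.strictMonoOn _) hpos
  have hleft := hs.injOn.leftInvOn_invFunOn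
  have hZ0 := hleft ⟨le_rfl, hM'.le⟩
  have hZb := hleft ⟨hM'.le, le_rfl⟩
  have hb := hs ⟨le_rfl, hM'.le⟩ ⟨hM'.le, le_rfl⟩ hM'
  rw [hx0] at hZ0 hb hbij hcurve
  rw [hxb] at hZb hb hbij hcurve
  exact ⟨hbij, hb, hZ0, hZb, hcurve⟩

theorem first_hjb (h : Admissible P γ) (z : ℝ) :
    Real.exp (-z) * (firstTol P γ z / etaBar P - (P.μ - P.η)) - P.δ * (c21 P * Real.exp (-z) *
      (Real.exp ((1 + P.δ * etaBar P) * (bigM P γ + z)) - 1)) = 0 := by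
  have hD := h.disc_pos
  have hn := h.etaBar_pos
  have e : c21 P * (1 + P.δ * etaBar P) = etaBar P * (P.μ - P.η) := div_mul_cancel₀ _ hD.ne'
  rw [firstTol]
  field_simp
  linear_combination Real.exp (-z) * e

theorem positive_payout_level (h : Admissible P γ) (hα : 1 < alpha P γ)
    (hlt : etaBar P * (P.μ - P.η) < g P γ 1 * c31 P γ 0) :
    0 < bigM P γ ∧
      BijOn (x1 P γ) (Icc (-bigM P γ) 0) (Icc 0 (bLevel P γ)) ∧
      BijOn (x2 P γ) (Icc 0 (Real.log (alpha P γ))) (Icc (bLevel P γ) (xLevel P γ)) ∧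
      IsGoodSolution P γ (vPos P γ) ∧ IsPayoutLevel (vPos P γ) (bLevel P γ) ∧
      IsRiskLevel P (vPos P γ) (xLevel P γ) ∧ 0 < bLevel P γ ∧ bLevel P γ < xLevel P γ := by
  have hα0 := one_pos.trans hα
  obtain ⟨hM, hexp⟩ := bigM_pos_and_exp h hlt
  obtain ⟨hbij1, hb, hZ0, hZb, hcurve1⟩ := isValueCurve_first h hlt
  have hx20 : x2 P γ 0 = bLevel P γ := by
    have := fBar_exp_neg P γ (c31 P γ 0) 0
    rw [neg_zero] at this
    rw [x2, this, zero_add]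
  have hx2b : x2 P γ (Real.log (alpha P γ)) = xLevel P γ := by
    rw [x2, Real.exp_log hα0, xLevel]
  obtain ⟨hbij2, hbx, hY0, hYx, hcurve2⟩ := isValueCurve_tail
    (f := x2 P γ) (vb := firstPiece P γ (bLevel P γ)) h hα (fun _ => rfl) (Real.log_pos hα) hx20 hx2b
    (riskTol_log_alpha_c31 h hα0)
  have htol : firstTol P γ 0 = riskTol P γ (c31 P γ 0) 0 0 := by
    rw [riskTol_zero, ← hexp, firstTol, add_zero]
  have hcurve := IsValueCurve.glue hb.le hcurve1 hcurve2
    (by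
      simp only [if_pos hbx.le]
      rw [hY0]
      -- Both pieces satisfy the HJB equation at `b` with the same slope and risk tolerance.
      have e1 := first_hjb h 0
      have e2 := middlePiece_hjb h (c31 P γ 0) 0 (bLevel P γ) (firstPiece P γ (bLevel P γ)) 0
        (bLevel P γ)
      rw [← htol] at e2
      have e3 : firstPiece P γ (bLevel P γ) = c21 P * Real.exp (-0) *
          (Real.exp ((1 + P.δ * etaBar P) * (bigM P γ + 0)) - 1) := by rw [firstPiece, hZb]
      rw [← e3] at e1
      refine mul_left_cancel₀ (add_pos h.hδ h.hγ).ne' ?_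
      linear_combination e2 - e1)
    (by
      simp only [if_pos hbx.le]
      rw [hY0, hZb])
    (by
      simp only [if_pos hbx.le]
      rw [hY0, hZb, htol])
  set w : ℝ → ℝ := fun x => if x ≤ bLevel P γ then Real.exp (-x1Inv P γ x)
    else if x ≤ xLevel P γ then Real.exp (-x2Inv P γ x) else lastSlope P γ (xLevel P γ) x with hw
  set χ : ℝ → ℝ := fun x => if x ≤ bLevel P γ then firstTol P γ (x1Inv P γ x)
    else if x ≤ xLevel P γ then riskTol P γ (c31 P γ 0) 0 (x2Inv P γ x)
    else lastTol P γ (xLevel P γ) x with hχ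
  change IsValueCurve (vPos P γ) w χ (Ici 0) at hcurve
  have hwb : w (bLevel P γ) = 1 := by simp [hw, hZb]
  have hvb : vPos P γ (bLevel P γ) = firstPiece P γ (bLevel P γ) := if_pos le_rfl
  have hχx : χ (xLevel P γ) = P.σ ^ 2 / P.μ := by
    simp only [hχ, if_neg hbx.not_ge, if_pos le_rfl]
    rw [x2Inv, hYx, riskTol_log_alpha_c31 h hα0]
  have hlow : ∀ x, 0 < x → x ≤ bLevel P γ → 1 ≤ w x := fun x hx hxb => by
    rw [← hwb]
    exact hcurve.w_anti.antitoneOn hx.le hb.le hxb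
  have hhigh : ∀ x, bLevel P γ < x → w x < 1 := fun x hx => by
    rw [← hwb]
    exact hcurve.w_anti hb.le (hb.trans hx).le hx
  have hx0 := hb.trans hbx
  refine ⟨hM, hbij1, hbij2, ?_, hcurve.isPayoutLevel hb.le hlow hhigh,
    hcurve.isRiskLevel h.hμ h.hσ hx0 hχx, hb, hbx⟩
  refine hcurve.isGoodSolution h.hγ h.hμ h.hσ ?_ hb.le hx0 hχx hlow hhigh ?_ ?_
  · rw [vPos, if_pos hb.le, firstPiece, hZ0]
    simp
  · intro x hx hxc
    rcases le_or_gt x (bLevel P γ) with hxb | hxb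
    · have e := first_hjb h (x1Inv P γ x)
      rw [min_eq_left hxb, vPos, hw, hχ]
      simp only [if_pos hxb, firstPiece]
      linear_combination e
    · have e := middlePiece_hjb h (c31 P γ 0) 0 (bLevel P γ) (firstPiece P γ (bLevel P γ))
        (x2Inv P γ x) x
      rw [min_eq_right hxb.le, hvb, vPos, hw, hχ]
      simp only [if_neg hxb.not_ge, if_pos hxc]
      exact e
  · intro x hxc
    have hxb := hbx.trans hxc
    have e := lastPiece_hjb h hα0 (bLevel P γ) (firstPiece P γ (bLevel P γ)) (xLevel P γ) x
    rw [min_eq_right hxb.le, hvb, vPos, hw, hχ]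
    simp only [if_neg hxb.not_ge, if_neg hxc.not_ge]
    exact e

/-! ### Zero payout level -/

/-- The equation for `M` has exactly one solution: the difference of its two sides decreases in
`e^M` as long as `e^M < (δ + γ) / γ`, and it changes sign between `1` and `α_γ`. -/
theorem exists_unique_isBigMZero (h : Admissible P γ) (hα : 1 < alpha P γ)
    (hlt : g P γ 1 * c31 P γ 0 < etaBar P * (P.μ - P.η)) :
    ∃ M, IsBigMZero P γ M ∧ ∀ M', IsBigMZero P γ M' → M' = M := by
  have hα0 := one_pos.trans hα
  have hμη := sub_pos.mpr h.hημ
  have hμ := h.hμ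
  have hn := h.etaBar_pos
  let Ψ : ℝ → ℝ := fun y => (P.μ - P.η) / (y * g P γ y)
    - (P.μ / (2 * alpha P γ * g P γ (alpha P γ))
      + (P.μ - P.η) * (H P γ 0 (alpha P γ) - H P γ 0 y))
  have hH : ∀ M, 0 ≤ M → H P γ (-M) (alpha P γ) = H P γ 0 (alpha P γ) - H P γ 0 (Real.exp M) := by
    intro M hM
    have hint : ∀ {z}, 0 < z → IntervalIntegrable (fun y => 1 / (y ^ 2 * g P γ y))
        MeasureTheory.volume 1 z := fun {z} hz =>
      ((continuousOn_const.div ((continuousOn_pow 2).mul (continuousOn_g P γ)) fun _ hs =>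
        (mul_pos (pow_pos hs 2) (g_pos h hs)).ne').mono fun s hs =>
        (lt_min one_pos hz).trans_le hs.1).intervalIntegrable
    rw [H, H, H, neg_neg, neg_zero, Real.exp_zero,
      intervalIntegral.integral_interval_sub_left (hint hα0) (hint (Real.exp_pos M))]
  have hiff : ∀ M, IsBigMZero P γ M ↔
      0 < M ∧ Real.exp M < alpha P γ ∧ Ψ (Real.exp M) = 0 := by
    intro M
    rw [IsBigMZero]
    refine and_congr_right fun hM => and_congr_right fun _ => ?_
    rw [hH M hM.le, ← sub_eq_zero]
  have hd : ∀ y ∈ Icc 1 (alpha P γ), HasDerivAt Ψ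
      ((P.μ - P.η) * (γ * etaBar P * y - etaBar P * (P.δ + γ)) / (y ^ 2 * g P γ y)) y := by
    intro y hy
    have hy0 : 0 < y := one_pos.trans_le hy.1
    have hg := g_pos h hy0
    have h1 := (hasDerivAt_const y (P.μ - P.η)).div
      ((hasDerivAt_id y).mul (hasDerivAt_g P γ hy0)) (mul_pos hy0 hg).ne'
    have h2 := (((hasDerivAt_H h 0 hy0).const_sub (H P γ 0 (alpha P γ))).const_mul
      (P.μ - P.η)).const_add (P.μ / (2 * alpha P γ * g P γ (alpha P γ)))
    refine (h1.sub h2).congr_deriv ?_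
    simp only [Pi.mul_apply, id_eq]
    field_simp
    ring
  have hcont : ContinuousOn Ψ (Icc 1 (alpha P γ)) :=
    fun y hy => (hd y hy).continuousAt.continuousWithinAt
  have hanti : StrictAntiOn Ψ (Icc 1 (alpha P γ)) := by
    refine strictAntiOn_of_hasDerivWithinAt_neg (convex_Icc _ _) hcont
      (fun y hy => (hd y (interior_subset hy)).hasDerivWithinAt) ?_
    intro y hy
    have hy' := interior_subset hy
    have hy0 : 0 < y := one_pos.trans_le hy'.1
    have hlt := hy'.2.trans_lt (alpha_lt h)
    rw [lt_div_iff₀ h.hγ] at hlt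
    have : etaBar P * (y * γ) < etaBar P * (γ + P.δ) := mul_lt_mul_of_pos_left hlt hn
    exact div_neg_of_neg_of_pos (mul_neg_of_pos_of_neg hμη (by linarith))
      (mul_pos (pow_pos hy0 2) (g_pos h hy0))
  have hΨ1 : 0 < Ψ 1 := by
    have hg1 := g_pos h one_pos
    have hH1 := H_exp_neg P γ 0
    rw [neg_zero, Real.exp_zero] at hH1
    have e : Ψ 1 = (etaBar P * (P.μ - P.η) - g P γ 1 * c31 P γ 0) / (etaBar P * g P γ 1) := by
      have hσ2 : P.σ ^ 2 = etaBar P * P.μ ^ 2 / 2 := by rw [etaBar]; field_simp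
      simp only [Ψ, hH1]
      rw [c31, hσ2]
      field_simp
      ring
    rw [e]
    exact div_pos (sub_pos.mpr hlt) (mul_pos hn hg1)
  have hΨα : Ψ (alpha P γ) < 0 := by
    have hgα := g_pos h hα0
    have e : Ψ (alpha P γ) = -(2 * P.η - P.μ) / (2 * alpha P γ * g P γ (alpha P γ)) := by
      simp only [Ψ]
      field_simp
      ring
    rw [e]
    exact div_neg_of_neg_of_pos (by linarith [h.hμη]) (by positivity)
  obtain ⟨y, hy, hy0⟩ := intermediate_value_Icc' hα.le hcont ⟨hΨα.le, hΨ1.le⟩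
  have hy1 : 1 < y := lt_of_le_of_ne hy.1 fun e => by rw [← e] at hy0; exact hΨ1.ne' hy0
  have hyα : y < alpha P γ := lt_of_le_of_ne hy.2 fun e => by rw [e] at hy0; exact hΨα.ne hy0
  have hexp := Real.exp_log (one_pos.trans hy1)
  refine ⟨Real.log y, (hiff _).mpr ⟨Real.log_pos hy1, by rwa [hexp], by rwa [hexp]⟩, ?_⟩
  intro M' hM'
  obtain ⟨h0, h1, h2⟩ := (hiff M').mp hM'
  have : Real.exp M' = y := hanti.injOn ⟨Real.one_le_exp h0.le, h1.le⟩ hy (h2.trans hy0.symm)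
  rw [← this, Real.log_exp]

/-- The equation for `M` says that the risk tolerance started at `η̄(μ - η)` for `z = M` reaches
`σ²/μ` at `z = log α_γ`. -/
theorem riskTol_log_alpha_c33 (h : Admissible P γ) (hα : 0 < alpha P γ) {M : ℝ}
    (hM : IsBigMZero P γ M) :
    riskTol P γ (c33 P γ (-M)) (-M) (Real.log (alpha P γ)) = P.σ ^ 2 / P.μ := by
  have hgα := g_pos h hα
  have hμ := h.hμ
  have e := hM.2.2
  have hσ2 : P.σ ^ 2 = etaBar P * P.μ ^ 2 / 2 := by rw [etaBar]; field_simp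
  rw [riskTol, Real.exp_log hα, c33, neg_neg, mul_div_assoc, e, hσ2]
  field_simp
  ring

/-- The value `η̄(μ - η)` of the risk tolerance at `x = 0`, which is what `v 0 = 0` requires. -/
theorem riskTol_c33 (h : Admissible P γ) (M : ℝ) :
    riskTol P γ (c33 P γ (-M)) (-M) M = etaBar P * (P.μ - P.η) := by
  have hg := g_pos h (Real.exp_pos M)
  have := H_exp_neg P γ (-M)
  rw [neg_neg] at this
  rw [riskTol, this, c33, neg_neg]
  field_simp
  ring

theorem zero_payout_level (h : Admissible P γ) (hα : 1 < alpha P γ) {M : ℝ}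
    (hM : IsBigMZero P γ M) :
    BijOn (x2Zero P γ M) (Icc M (Real.log (alpha P γ))) (Icc 0 (xLevelZero P γ M)) ∧
      IsGoodSolution P γ (vZero P γ M) ∧ IsPayoutLevel (vZero P γ M) 0 ∧
      IsRiskLevel P (vZero P γ M) (xLevelZero P γ M) := by
  have hα0 := one_pos.trans hα
  have hn := h.etaBar_pos
  have hx20 : x2Zero P γ M M = 0 := by
    have := fBar_exp_neg P γ (c33 P γ (-M)) (-M)
    rwa [neg_neg] at this
  have hx2b : x2Zero P γ M (Real.log (alpha P γ)) = xLevelZero P γ M := by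
    rw [x2Zero, Real.exp_log hα0, xLevelZero]
  obtain ⟨hbij, hx0, hY0, hYx, hcurve⟩ := isValueCurve_tail (c := 0) (vb := 0) h hα
    (fun z => (add_zero (x2Zero P γ M z)).symm) ((Real.lt_log_iff_exp_lt hα0).mpr hM.2.1) hx20
    hx2b (riskTol_log_alpha_c33 h hα0 hM)
  set w : ℝ → ℝ := fun x => if x ≤ xLevelZero P γ M then Real.exp (-x2ZeroInv P γ M x)
    else lastSlope P γ (xLevelZero P γ M) x with hw
  set χ : ℝ → ℝ := fun x => if x ≤ xLevelZero P γ M then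
    riskTol P γ (c33 P γ (-M)) (-M) (x2ZeroInv P γ M x)
    else lastTol P γ (xLevelZero P γ M) x with hχ
  change IsValueCurve (vZero P γ M) w χ (Ici 0) at hcurve
  have hw0 : w 0 < 1 := by
    simp only [hw, if_pos hx0.le]
    rw [x2ZeroInv, hY0]
    exact Real.exp_lt_one_iff.mpr (neg_neg_of_pos hM.1)
  have hv0 : vZero P γ M 0 = 0 := by
    rw [vZero, if_pos hx0.le, middlePiece_eq, x2ZeroInv, hY0, riskTol_c33 h]
    field_simp
    ring
  have hχx : χ (xLevelZero P γ M) = P.σ ^ 2 / P.μ := by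
    simp only [hχ, if_pos le_rfl]
    rw [x2ZeroInv, hYx, riskTol_log_alpha_c33 h hα0 hM]
  have hlow : ∀ x, 0 < x → x ≤ 0 → 1 ≤ w x := fun x hx hx' => absurd hx hx'.not_gt
  have hhigh : ∀ x, 0 < x → w x < 1 := fun x hx =>
    (hcurve.w_anti self_mem_Ici hx.le hx).trans hw0
  refine ⟨hbij, ?_, hcurve.isPayoutLevel le_rfl hlow hhigh,
    hcurve.isRiskLevel h.hμ h.hσ hx0 hχx⟩
  refine hcurve.isGoodSolution h.hγ h.hμ h.hσ hv0 le_rfl hx0 hχx hlow hhigh ?_ ?_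
  · intro x hx hxc
    have e := middlePiece_hjb h (c33 P γ (-M)) (-M) 0 0 (x2ZeroInv P γ M x) x
    rw [min_eq_right hx.le, hv0, vZero, hw, hχ]
    simp only [if_pos hxc]
    exact e
  · intro x hxc
    have e := lastPiece_hjb h hα0 0 0 (xLevelZero P γ M) x
    rw [min_eq_right (hx0.trans hxc).le, hv0, vZero, hw, hχ]
    simp only [if_neg hxc.not_ge]
    exact e

end PeriodicDividend

theorem proposition3p13 (P : PeriodicDividend.Params)
    (hη : 0 < P.η) (hημ : P.η < P.μ) (hμη : P.μ < 2 * P.η) (hσ : 0 < P.σ) (hδ : 0 < P.δ)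
    (γ₂ : ℝ) (hγ₂ : γ₂ ∈ Set.Ioo 0 (PeriodicDividend.gamma1 P))
    (hf : PeriodicDividend.f3 P γ₂ = PeriodicDividend.f4 P γ₂) :
    (∀ γ ∈ Set.Ioo γ₂ (PeriodicDividend.gamma1 P),
      0 < PeriodicDividend.bigM P γ ∧
      Set.BijOn (PeriodicDividend.x1 P γ) (Set.Icc (-PeriodicDividend.bigM P γ) 0)
        (Set.Icc 0 (PeriodicDividend.bLevel P γ)) ∧
      Set.BijOn (PeriodicDividend.x2 P γ) (Set.Icc 0 (Real.log (PeriodicDividend.alpha P γ)))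
        (Set.Icc (PeriodicDividend.bLevel P γ) (PeriodicDividend.xLevel P γ)) ∧
      PeriodicDividend.IsGoodSolution P γ (PeriodicDividend.vPos P γ) ∧
      PeriodicDividend.IsPayoutLevel (PeriodicDividend.vPos P γ) (PeriodicDividend.bLevel P γ) ∧
      PeriodicDividend.IsRiskLevel P (PeriodicDividend.vPos P γ) (PeriodicDividend.xLevel P γ) ∧
      0 < PeriodicDividend.bLevel P γ ∧
      PeriodicDividend.bLevel P γ < PeriodicDividend.xLevel P γ) ∧
    (∀ γ ∈ Set.Ioo 0 γ₂,
      ∃ M : ℝ, PeriodicDividend.IsBigMZero P γ M ∧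
        (∀ M' : ℝ, PeriodicDividend.IsBigMZero P γ M' → M' = M) ∧
        Set.BijOn (PeriodicDividend.x2Zero P γ M)
          (Set.Icc M (Real.log (PeriodicDividend.alpha P γ)))
          (Set.Icc 0 (PeriodicDividend.xLevelZero P γ M)) ∧
        PeriodicDividend.IsGoodSolution P γ (PeriodicDividend.vZero P γ M) ∧
        PeriodicDividend.IsPayoutLevel (PeriodicDividend.vZero P γ M) 0 ∧
        PeriodicDividend.IsRiskLevel P (PeriodicDividend.vZero P γ M)
          (PeriodicDividend.xLevelZero P γ M)) := by
  have adm : ∀ γ, 0 < γ → PeriodicDividend.Admissible P γ := fun γ hγ => ⟨hη, hημ, hμη, hσ, hδ, hγ⟩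
  have h₂ := adm γ₂ hγ₂.1
  have hone := PeriodicDividend.f3Ratio_eq_one h₂ hγ₂.2 hf
  have hl := h₂.loading_pos
  refine ⟨fun γ hγ => ?_, fun γ hγ => ?_⟩
  · have h := adm γ (hγ₂.1.trans hγ.1)
    have hα := PeriodicDividend.one_lt_alpha h hγ.2
    refine PeriodicDividend.positive_payout_level h hα ?_
    rw [PeriodicDividend.g_one_mul_c31 h hα, lt_mul_iff_one_lt_right hl, ← hone]
    exact PeriodicDividend.f3Ratio_lt h₂ h hγ.1 hγ.2
  · have h := adm γ hγ.1
    have hα := PeriodicDividend.one_lt_alpha h (hγ.2.trans hγ₂.2)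
    have hlt : PeriodicDividend.g P γ 1 * PeriodicDividend.c31 P γ 0 <
        PeriodicDividend.etaBar P * (P.μ - P.η) := by
      rw [PeriodicDividend.g_one_mul_c31 h hα, mul_lt_iff_lt_one_right hl, ← hone]
      exact PeriodicDividend.f3Ratio_lt h h₂ hγ.2 hγ₂.2
    obtain ⟨M, hM, huniq⟩ := PeriodicDividend.exists_unique_isBigMZero h hα hlt
    exact ⟨M, hM, huniq, PeriodicDividend.zero_payout_level h hα hM⟩
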